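/- Let $M$ be a two-sphere of revolution, that is, $S^2$ with a smooth Riemannian metric which in geodesic polar coordinates $(r,\theta)$ around a pole $p$ has the form $dr^2+m(r)^2d\theta^2$, $0<r<2a$, $\theta\in\mathbb R/2\pi\mathbb Z$, where $2a$ is the distance between the two poles. Let $d$ be its Riemannian distance, $b=m(a)$ the radius of the equator $\{r=a\}$, and $K(r)=-m''(r)/m(r)$ the Gaussian curvature along the parallel at distance $r$ from $p$. Assume (A1) $m(r)=\psi((a-r)^2)$ near $r=a$ for some smooth function $\psi$; (A2) $K$ is non-decreasing on $(0,a]$, i.e. along meridians from the pole $p$ to the equator. Write $m(r)=b-\alpha(a-r)^2+\beta(a-r)^4+O((a-r)^6)$ as $r\to a$. For $|\eta|<\pi/2$ let $c_\eta$ be the unit speed geodesic which starts at the equator point $x=(a,0)$ with $\dot r(0)=-\sin\eta$, $\dot\theta(0)=\cos\eta/b$; for $0\le\eta<\pi/2$ this is the geodesic $c_\nu$ with Clairaut constant $\nu=b\cos\eta$, and $c_\eta$ with $\eta=0$ (that is, $\nu=b$) is the equator. For $0<\nu<b$ put $$\varphi(\nu)=2\int_R^a\frac{\nu\,dr}{m(r)\sqrt{m(r)^2-\nu^2}},\qquad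 R\in(0,a],\ m(R)=\nu ,$$ which is the longitude at which $c_\nu$ first returns to the equator. Then the limit $\theta_{\mathrm{cut}}=\lim_{\nu\to b^-}\varphi(\nu)$ exists; the point $y=(a,\theta_{\mathrm{cut}})$, which the equator reaches at the time $t_{\mathrm{cut}}=b\,\theta_{\mathrm{cut}}$, is called the cut-conjugate point. A variation of the equatorial geodesic is a smooth curve $s\mapsto(\eta(s),t(s))$, $|s|<\varepsilon$, with $|\eta(s)|<\pi/2$, $(\eta(0),t(0))=(0,t_{\mathrm{cut}})$ and $(\eta'(0),t'(0))\neq(0,0)$. The following hold. 1. There exists a variation with $d\big(c_{\eta(s)}(t(s)),y\big)=O(s^3)$ as $s\to0$. 2. If $K''(a)\ne0$, then there is no variation with $d\big(c_{\eta(s)}(t(s)),y\big)=o(s^3)$ as $s\to 0$, not even as $s\to0^+$ only. 3. As $\eta\to0^+$, with $\nu=b\cos\eta$, the distance between $y$ and the segment of $c_\nu$ from $x$ to its first return to the equator (longitudes $0\le\theta\le\varphi(\nu)$) equals $C\eta^3+O(\eta^4)$, where $$C=\frac{(6b\beta-\alpha^2)\sqrt b\,\pi}{16\sqrt2\,\alpha^{5/2}},$$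 and $C>0$ if $K''(a)\neq0$. -/

import Mathlib

open Set Filter Topology Asymptotics
open scoped ContDiff

noncomputable section

/-- A two-sphere of revolution: the sphere with a smooth Riemannian metric which in geodesic polar
coordinates `(r, θ)` around a pole reads `dr² + m(r)² dθ²`, `0 < r < 2a`, `θ ∈ ℝ/2πℤ`, the poles
being `r = 0` and `r = 2a`. The metric extends smoothly over the two poles exactly when the profile
`m` extends to a smooth function which is odd about `0` and about `2a` with slopes `1` and `-1`
there; `m` denotes this (unique) extension to the whole line. -/
structure TwoSphereOfRevolution where
  /-- half of the distance between the poles -/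
  a : ℝ
  a_pos : 0 < a
  /-- the profile -/
  m : ℝ → ℝ
  smooth : ContDiff ℝ ∞ m
  pos : ∀ r ∈ Ioo 0 (2 * a), 0 < m r
  odd_zero : ∀ r, m (-r) = -m r
  odd_two_a : ∀ r, m (2 * a + r) = -m (2 * a - r)
  deriv_zero : deriv m 0 = 1
  deriv_two_a : deriv m (2 * a) = -1

namespace TwoSphereOfRevolution

variable (S : TwoSphereOfRevolution)

/-- The radius of the equator `r = a`. -/
def b : ℝ := S.m S.a

/-- The Gaussian curvature along the parallel at distance `r` from the pole. -/
def K (r : ℝ) : ℝ := -iteratedDeriv 2 S.m r / S.m r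

/-- Assumption (A1): reflection symmetry of the metric near the equator. -/
def LocallyReflectionSymmetric : Prop :=
  ∃ ψ : ℝ → ℝ, ∃ U ∈ 𝓝 (0 : ℝ), ContDiffOn ℝ ∞ ψ U ∧ ∀ᶠ r in 𝓝 S.a, S.m r = ψ ((S.a - r) ^ 2)

/-- Assumption (A2): the curvature is non-decreasing along meridians from the pole `r = 0` to the
equator. -/
def CurvatureMonotone : Prop := MonotoneOn S.K (Ioc 0 S.a)

/-- Taylor coefficient in `m(r) = b - α (a - r)² + β (a - r)⁴ + O((a - r)⁶)`. -/
def α : ℝ := -iteratedDeriv 2 S.m S.a / 2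

/-- Taylor coefficient in `m(r) = b - α (a - r)² + β (a - r)⁴ + O((a - r)⁶)`. -/
def β : ℝ := iteratedDeriv 4 S.m S.a / 24

/-- Two pairs of polar coordinates that describe the same point of the sphere. -/
def SamePoint (P Q : ℝ × ℝ) : Prop :=
  P.1 = Q.1 ∧ ((∃ k : ℤ, Q.2 = P.2 + 2 * Real.pi * k) ∨ P.1 = 0 ∨ P.1 = 2 * S.a)

/-- The Riemannian length of the curve with polar coordinates `(u t, v t)`, `0 ≤ t ≤ 1`. -/
def curveLength (u v : ℝ → ℝ) : ℝ :=
  ∫ t in (0 : ℝ)..1, √(deriv u t ^ 2 + S.m (u t) ^ 2 * deriv v t ^ 2)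

/-- `S.JoinedBy P Q L`: there is a piecewise `C¹` curve of length `L` on the sphere from the point
with polar coordinates `P` to the one with polar coordinates `Q`. Between two pieces the polar
coordinates may be changed to others of the same point, so curves can wind around the axis and
pass through the poles. -/
inductive JoinedBy : ℝ × ℝ → ℝ × ℝ → ℝ → Prop
  | curve (u v : ℝ → ℝ) (hu : ContDiff ℝ 1 u) (hv : ContDiff ℝ 1 v)
      (hmem : ∀ t ∈ Icc (0 : ℝ) 1, u t ∈ Icc 0 (2 * S.a)) :
      JoinedBy (u 0, v 0) (u 1, v 1) (S.curveLength u v)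
  | same (P Q : ℝ × ℝ) (h : S.SamePoint P Q) : JoinedBy P Q 0
  | trans (P Q R : ℝ × ℝ) (L L' : ℝ) (h : JoinedBy P Q L) (h' : JoinedBy Q R L') :
      JoinedBy P R (L + L')

/-- The Riemannian distance between the points with polar coordinates `P` and `Q`: the infimum of
the lengths of the piecewise `C¹` curves joining them. -/
def rdist (P Q : ℝ × ℝ) : ℝ := sInf {L | S.JoinedBy P Q L}

/-- The geodesic equations of `dr² + m(r)² dθ²` for a curve `t ↦ (r t, θ t)` that avoids the
poles. -/
structure IsGeodesic (r θ : ℝ → ℝ) : Prop where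
  smooth_r : ContDiff ℝ ∞ r
  smooth_θ : ContDiff ℝ ∞ θ
  mem : ∀ t, r t ∈ Ioo 0 (2 * S.a)
  eq_r : ∀ t, deriv (deriv r) t = S.m (r t) * deriv S.m (r t) * deriv θ t ^ 2
  eq_θ : ∀ t, deriv (deriv θ) t = -2 * (deriv S.m (r t) / S.m (r t)) * deriv r t * deriv θ t

/-- `t ↦ c t = (r(t), θ(t))` is the unit speed geodesic from the equator point `x = (a, 0)` whose
initial velocity makes the signed angle `η` with `∂/∂θ`, positive angles pointing towards the pole
`r = 0`. For `0 ≤ η < π/2` it is the geodesic `c_ν` with Clairaut constant `ν = b cos η`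
(and `r'(0) < 0` if `η > 0`); for `η = 0` it is the equator. -/
structure IsEquatorGeodesic (η : ℝ) (c : ℝ → ℝ × ℝ) : Prop where
  geodesic : S.IsGeodesic (fun t => (c t).1) (fun t => (c t).2)
  start : c 0 = (S.a, 0)
  velocity_r : deriv (fun t => (c t).1) 0 = -Real.sin η
  velocity_θ : deriv (fun t => (c t).2) 0 = Real.cos η / S.b

/-- `R(ν)`: the point of `(0, a]` with `m(R) = ν`. -/
def R (ν : ℝ) : ℝ := sInf {r | r ∈ Ioc 0 S.a ∧ S.m r = ν}

/-- `φ(ν) = 2 ∫_R^a ν / (m √(m² - ν²)) dr`: the longitude of the first return of the geodesic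
`c_ν` to the equator. -/
def φ (ν : ℝ) : ℝ := 2 * ∫ r in (S.R ν)..S.a, ν / (S.m r * √(S.m r ^ 2 - ν ^ 2))

/-- A variation of the equatorial geodesic at time `T`: a regular smooth curve
`s ↦ (η(s), t(s))`, `|s| < ε`, in the space of parameters with `η(0) = 0` and `t(0) = T`. -/
structure IsVariation (T ε : ℝ) (η t : ℝ → ℝ) : Prop where
  eps_pos : 0 < ε
  smooth_η : ContDiffOn ℝ ∞ η (Ioo (-ε) ε)
  smooth_t : ContDiffOn ℝ ∞ t (Ioo (-ε) ε)
  mem : ∀ s ∈ Ioo (-ε) ε, η s ∈ Ioo (-(Real.pi / 2)) (Real.pi / 2)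
  η_zero : η 0 = 0
  t_zero : t 0 = T
  regular : deriv η 0 ≠ 0 ∨ deriv t 0 ≠ 0

/-- The distance between the point `y` and the segment of the curve `c` which consists of the
points `c t`, `t ≥ 0`, of longitude at most `Θ`. -/
def distToSegment (y : ℝ × ℝ) (c : ℝ → ℝ × ℝ) (Θ : ℝ) : ℝ :=
  sInf ((fun t => S.rdist (c t) y) '' {t | 0 ≤ t ∧ (c t).2 ≤ Θ})

/-- The constant `(6bβ - α²) √b π / (16 √2 α^{5/2})`. -/
def cubicConst : ℝ :=
  (6 * S.b * S.β - S.α ^ 2) * √S.b * Real.pi / (16 * √2 * S.α ^ (5 / 2 : ℝ))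

end TwoSphereOfRevolution

end

/-! ### Taylor estimates and first order expansions -/

/-! Put `ν = b cos η` and `q = b - ν = ρ²` with `ρ = √(2b) sin(η/2)`. Near the equator let `u` be
the root of `b - m` with the sign of `a - r`, and let `w = -r' m / √(m + ν)`. Clairaut's relation
and unit speed give `u² + w² = q`, and the geodesic equation says that `(u, w)` turns with an
explicit positive speed: `u = ρ sin τ`, `w = ρ cos τ` (`exists_angle`). For `η > 0` the first return
to the equator is `τ = π`.

The densities `dt/dτ` and `dθ/dτ` have first order expansions in `q` and `p = b - m = q sin² τ`,
with error `O(q²)` uniform in time (`firstOrder_time`). Integration in `τ` gives time and longitude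
(`exists_oscillation`). Over half a turn `sin²` averages to `1/2`, so that `φ(b cos η) = θcut +
(C/b) η² + O(η⁴)` with `θcut = π/√(2αb)` (`φ_isBigO`).

Around `τ = π` the longitude minus `θcut` is `(τ - π)/√(2αb) + (C/b) η²`, while `a - r` is
`-b/√(2αb) · η (τ - π)`, both up to `O(η⁴)`. Eliminating `τ - π`: where the longitude is `θcut +
O(η³)`, the height over the equator is `C η³ + O(η⁴)` (`exists_height_bound`). A point of `c_η` at
distance less than `C|η|³` from `y` has longitude `θcut + O(η³)`, hence that height; so the distance
is never below `C|η|³ - O(η⁴)` (`exists_rdist_lower_bound`). Choosing the time so that the longitude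
agrees with `θcut` to the required order gives the variation of order three. Conversely, distance
`o(s³)` with `C > 0` forces `η'(0) = 0` and then `t'(0) = 0`.

Monotonicity of `K` makes `m` increase up to the equator, gives `α > 0` and `C ≥ 0`, and through
`2αb ≥ 1` gives `θcut ≤ π`, which keeps the segment of `c_η` from passing near `y` after winding
around the axis. -/

theorem isBigO_pow_succ_of_hasDerivAt {f f' : ℝ → ℝ} {a : ℝ} {n : ℕ}
    (hf : ∀ᶠ x in 𝓝 a, HasDerivAt f (f' x) x) (ha : f a = 0)
    (h : f' =O[𝓝 a] fun x => (x - a) ^ n) : f =O[𝓝 a] fun x => (x - a) ^ (n + 1) := by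
  obtain ⟨C, hC⟩ := h.bound
  obtain ⟨ε, hε, hball⟩ := Metric.eventually_nhds_iff_ball.1 (hf.and hC)
  refine IsBigO.of_bound C ?_
  filter_upwards [Metric.ball_mem_nhds a hε] with x hx
  have hsub : ∀ y ∈ segment ℝ a x, y ∈ Metric.ball a ε ∧ |y - a| ≤ |x - a| := by
    intro y hy
    refine ⟨(convex_ball a ε).segment_subset (Metric.mem_ball_self hε) hx hy, ?_⟩
    have := segment_subset_closedBall_left a x hy
    simpa [Real.dist_eq, abs_sub_comm] using this
  have hC0 : 0 ≤ C * |x - a| ^ n := by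
    have := (hball x hx).2
    rw [Real.norm_eq_abs, norm_pow, Real.norm_eq_abs] at this
    exact (abs_nonneg _).trans this
  have key := (convex_segment a x).norm_image_sub_le_of_norm_hasDerivWithin_le
    (f := f) (f' := f') (C := C * |x - a| ^ n) (x := a) (y := x)
    (fun y hy => ((hball y (hsub y hy).1).1).hasDerivWithinAt) (fun y hy => ?_)
    (left_mem_segment ℝ a x) (right_mem_segment ℝ a x)
  · rw [ha, sub_zero] at key
    rw [norm_pow, pow_succ, ← mul_assoc]
    simpa using key
  · refine ((hball y (hsub y hy).1).2).trans ?_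
    rw [norm_pow, Real.norm_eq_abs]
    rcases le_or_gt 0 C with h | h
    · exact mul_le_mul_of_nonneg_left (pow_le_pow_left₀ (abs_nonneg _) (hsub y hy).2 n) h
    -- The constant supplied by the `O` bound may be negative; then `0 ≤ C |x - a|ⁿ` leaves only `|x
    -- - a|ⁿ = 0`.
    · have h1 : |x - a| ^ n ≤ 0 := by
        by_contra h2
        push Not at h2
        nlinarith
      have h3 : |y - a| ^ n ≤ |x - a| ^ n := pow_le_pow_left₀ (abs_nonneg _) (hsub y hy).2 n
      have h4 : 0 ≤ |y - a| ^ n := by positivity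
      have h5 : |y - a| ^ n = 0 := by linarith
      have h6 : |x - a| ^ n = 0 := by linarith
      rw [h5, h6]

theorem ContDiffAt.deriv_of_succ {f : ℝ → ℝ} {a : ℝ} {n : WithTop ℕ∞}
    (hf : ContDiffAt ℝ (n + 1) f a) : ContDiffAt ℝ n (deriv f) a := by
  have : ContDiffAt ℝ n (fun x => fderiv ℝ f x 1) a :=
    (hf.fderiv_right le_rfl).clm_apply contDiffAt_const
  simpa using this

theorem ContDiffAt.isBigO_sub_taylor_one {f : ℝ → ℝ} {a : ℝ} (hf : ContDiffAt ℝ 2 f a) :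
    (fun x => f x - (f a + deriv f a * (x - a))) =O[𝓝 a] fun x => (x - a) ^ 2 := by
  have h1 : ∀ᶠ x in 𝓝 a, HasDerivAt f (deriv f x) x := by
    filter_upwards [hf.eventually (by simp)] with x hx
    exact (hx.differentiableAt (by simp)).hasDerivAt
  have h2 : DifferentiableAt ℝ (deriv f) a := by
    exact (hf.deriv_of_succ (n := 1)).differentiableAt (by simp)
  refine isBigO_pow_succ_of_hasDerivAt (f' := fun x => deriv f x - deriv f a) ?_ (by simp) ?_
  · filter_upwards [h1] with x hx
    have := hx.fun_sub (((hasDerivAt_id x).sub_const a).const_mul (deriv f a) |>.const_add (f a))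
    simpa using this
  · simpa using h2.isBigO_sub

/-- `f = f₀ + f₁ q + f₂ p + O(q²)` along `l`. -/
noncomputable def FirstOrder {ι : Type*} (l : Filter ι) (q p f : ι → ℝ) (f₀ f₁ f₂ : ℝ) : Prop :=
  (fun i => f i - (f₀ + f₁ * q i + f₂ * p i)) =O[l] fun i => q i ^ 2

namespace FirstOrder

variable {ι : Type*} {l : Filter ι} {q p f g : ι → ℝ} {f₀ f₁ f₂ g₀ g₁ g₂ : ℝ}

theorem of_eq (h : FirstOrder l q p f f₀ f₁ f₂) (h₀ : f₀ = g₀) (h₁ : f₁ = g₁) (h₂ : f₂ = g₂) :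
    FirstOrder l q p f g₀ g₁ g₂ := by
  subst h₀ h₁ h₂; exact h

theorem congr (h : FirstOrder l q p f f₀ f₁ f₂) (hfg : f =ᶠ[l] g) :
    FirstOrder l q p g f₀ f₁ f₂ := by
  refine IsBigO.congr' h ?_ EventuallyEq.rfl
  filter_upwards [hfg] with i hi
  rw [hi]

theorem const (c : ℝ) : FirstOrder l q p (fun _ => c) c 0 0 := by
  simp [FirstOrder, isBigO_zero]

theorem fst : FirstOrder l q p q 0 1 0 := by
  simp [FirstOrder, isBigO_zero]

theorem snd : FirstOrder l q p p 0 0 1 := by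
  simp [FirstOrder, isBigO_zero]

theorem add (hf : FirstOrder l q p f f₀ f₁ f₂) (hg : FirstOrder l q p g g₀ g₁ g₂) :
    FirstOrder l q p (fun i => f i + g i) (f₀ + g₀) (f₁ + g₁) (f₂ + g₂) := by
  refine (IsBigO.add hf hg).congr_left fun i => ?_
  ring

theorem sub (hf : FirstOrder l q p f f₀ f₁ f₂) (hg : FirstOrder l q p g g₀ g₁ g₂) :
    FirstOrder l q p (fun i => f i - g i) (f₀ - g₀) (f₁ - g₁) (f₂ - g₂) := by
  refine (IsBigO.sub hf hg).congr_left fun i => ?_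
  ring

theorem linear_isBigO (hp : p =O[l] q) (c d : ℝ) :
    (fun i => c * q i + d * p i) =O[l] q :=
  ((isBigO_refl q l).const_mul_left c).add (hp.const_mul_left d)

theorem sub_const_isBigO (hf : FirstOrder l q p f f₀ f₁ f₂) (hq : Tendsto q l (𝓝 0))
    (hp : p =O[l] q) : (fun i => f i - f₀) =O[l] q := by
  have h1 : (fun i => q i ^ 2) =O[l] q := by
    have := (isBigO_refl q l).mul (hq.isBigO_one ℝ)
    simpa [sq] using this
  have := (IsBigO.trans hf h1).add (linear_isBigO hp f₁ f₂)
  refine this.congr_left fun i => ?_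
  ring

theorem tendsto (hf : FirstOrder l q p f f₀ f₁ f₂) (hq : Tendsto q l (𝓝 0))
    (hp : p =O[l] q) : Tendsto f l (𝓝 f₀) := by
  have := (hf.sub_const_isBigO hq hp).trans_tendsto hq
  simpa using this.add_const f₀

/-- Since `p = O(q)`, products of two first order terms are absorbed by the error `O(q²)`. This
closes the expansions under algebra and, with `comp`, under `C²` functions. -/
theorem mul (hf : FirstOrder l q p f f₀ f₁ f₂) (hg : FirstOrder l q p g g₀ g₁ g₂)
    (hq : Tendsto q l (𝓝 0)) (hp : p =O[l] q) :
    FirstOrder l q p (fun i => f i * g i) (f₀ * g₀) (f₀ * g₁ + f₁ * g₀) (f₀ * g₂ + f₂ * g₀) := by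
  have h1 : (fun i => (f i - (f₀ + f₁ * q i + f₂ * p i)) * g i) =O[l] fun i => q i ^ 2 := by
    have := IsBigO.mul hf ((hg.tendsto hq hp).isBigO_one ℝ)
    simpa using this
  have h2 : (fun i => (f i - f₀) * (g₁ * q i + g₂ * p i)) =O[l] fun i => q i ^ 2 := by
    have := (hf.sub_const_isBigO hq hp).mul (linear_isBigO hp g₁ g₂)
    simpa [sq] using this
  have h3 : (fun i => (f₁ * q i + f₂ * p i) * (g i - g₀)) =O[l] fun i => q i ^ 2 := by
    have := (linear_isBigO hp f₁ f₂).mul (hg.sub_const_isBigO hq hp)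
    simpa [sq] using this
  have h4 : (fun i => f₀ * (g i - (g₀ + g₁ * q i + g₂ * p i))) =O[l] fun i => q i ^ 2 :=
    IsBigO.const_mul_left hg f₀
  refine ((h1.add h3).add h4).congr_left fun i => ?_
  ring

theorem comp (hf : FirstOrder l q p f f₀ f₁ f₂) (hq : Tendsto q l (𝓝 0)) (hp : p =O[l] q)
    {F : ℝ → ℝ} (hF : ContDiffAt ℝ 2 F f₀) :
    FirstOrder l q p (fun i => F (f i)) (F f₀) (deriv F f₀ * f₁) (deriv F f₀ * f₂) := by
  have h1 := hF.isBigO_sub_taylor_one.comp_tendsto (hf.tendsto hq hp)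
  have h2 : (fun i => (f i - f₀) ^ 2) =O[l] fun i => q i ^ 2 :=
    (hf.sub_const_isBigO hq hp).pow 2
  have h3 := (h1.trans h2).add (IsBigO.const_mul_left hf (deriv F f₀))
  refine h3.congr_left fun i => ?_
  simp only [Function.comp]
  ring

theorem sqrt (hf : FirstOrder l q p f f₀ f₁ f₂) (hq : Tendsto q l (𝓝 0)) (hp : p =O[l] q)
    (h0 : 0 < f₀) :
    FirstOrder l q p (fun i => √(f i)) (√f₀) (f₁ / (2 * √f₀)) (f₂ / (2 * √f₀)) := by
  refine (hf.comp hq hp (Real.contDiffAt_sqrt h0.ne')).of_eq rfl ?_ ?_ <;>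
  · rw [(Real.hasDerivAt_sqrt h0.ne').deriv]; ring

theorem inv (hf : FirstOrder l q p f f₀ f₁ f₂) (hq : Tendsto q l (𝓝 0)) (hp : p =O[l] q)
    (h0 : f₀ ≠ 0) :
    FirstOrder l q p (fun i => (f i)⁻¹) f₀⁻¹ (-f₁ / f₀ ^ 2) (-f₂ / f₀ ^ 2) := by
  refine (hf.comp hq hp (contDiffAt_inv ℝ h0)).of_eq rfl ?_ ?_ <;>
  · rw [(hasDerivAt_inv h0).deriv]; field_simp

theorem div (hf : FirstOrder l q p f f₀ f₁ f₂) (hg : FirstOrder l q p g g₀ g₁ g₂)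
    (hq : Tendsto q l (𝓝 0)) (hp : p =O[l] q) (h0 : g₀ ≠ 0) :
    FirstOrder l q p (fun i => f i / g i) (f₀ / g₀) ((f₁ * g₀ - f₀ * g₁) / g₀ ^ 2)
      ((f₂ * g₀ - f₀ * g₂) / g₀ ^ 2) := by
  refine ((hf.mul (hg.inv hq hp h0) hq hp).congr ?_).of_eq ?_ ?_ ?_
  · filter_upwards with i using (div_eq_mul_inv _ _).symm
  · rw [div_eq_mul_inv]
  · field_simp; ring
  · field_simp; ring

end FirstOrder

namespace TwoSphereOfRevolution

/-! ### The profile near the equator -/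

theorem b_pos (S : TwoSphereOfRevolution) : 0 < S.b := S.pos _ ⟨S.a_pos, by linarith [S.a_pos]⟩

theorem contDiffAt_top_deriv {f : ℝ → ℝ} {x : ℝ} (hf : ContDiffAt ℝ ∞ f x) :
    ContDiffAt ℝ ∞ (deriv f) x :=
  ContDiffAt.deriv_of_succ (by simpa using hf)

theorem eventually_hasDerivAt_of_contDiffAt {f : ℝ → ℝ} {x : ℝ} (hf : ContDiffAt ℝ ∞ f x) :
    ∀ᶠ z in 𝓝 x, HasDerivAt f (deriv f z) z := by
  have h2 : ContDiffAt ℝ 1 f x := hf.of_le (by exact_mod_cast le_top)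
  filter_upwards [h2.eventually (by simp)] with z hz
  exact (hz.differentiableAt (by simp)).hasDerivAt

theorem tendsto_sq_zero : Tendsto (fun x : ℝ => x ^ 2) (𝓝 0) (𝓝 0) := by
  have : Continuous fun x : ℝ => x ^ 2 := by fun_prop
  simpa using this.tendsto 0

/-- The derivative of `x ↦ f (x²)`, at all points near `0`. -/
theorem eventually_hasDerivAt_comp_sq {f : ℝ → ℝ} (hf : ContDiffAt ℝ ∞ f 0) :
    ∀ᶠ x in 𝓝 (0 : ℝ), HasDerivAt (fun x => f (x ^ 2)) (deriv f (x ^ 2) * (2 * x)) x := by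
  filter_upwards [tendsto_sq_zero.eventually (eventually_hasDerivAt_of_contDiffAt hf)] with x hx
  have h : HasDerivAt (fun x : ℝ => x ^ 2) (2 * x) x := by simpa using hasDerivAt_pow 2 x
  exact HasDerivAt.comp x hx h

variable {S : TwoSphereOfRevolution} {ψ : ℝ → ℝ}

theorem LocallyReflectionSymmetric.exists_profile (h : S.LocallyReflectionSymmetric) :
    ∃ ψ : ℝ → ℝ, ContDiffAt ℝ ∞ ψ 0 ∧ (fun x => S.m (S.a - x)) =ᶠ[𝓝 0] fun x => ψ (x ^ 2) := by
  obtain ⟨ψ, U, hU, hψ, hm⟩ := h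
  refine ⟨ψ, hψ.contDiffAt hU, ?_⟩
  have h0 : Tendsto (fun x : ℝ => S.a - x) (𝓝 0) (𝓝 S.a) := by
    have : Continuous fun x : ℝ => S.a - x := by fun_prop
    simpa using this.tendsto 0
  filter_upwards [h0.eventually hm] with x hx
  simpa using hx

theorem contDiff_iteratedDeriv (S : TwoSphereOfRevolution) (n : ℕ) : ContDiff ℝ ∞ (iteratedDeriv n S.m) := by
  rw [iteratedDeriv_eq_iterate]
  exact S.smooth.iterate_deriv n

theorem hasDerivAt_iteratedDeriv (S : TwoSphereOfRevolution) (n : ℕ) (r : ℝ) :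
    HasDerivAt (iteratedDeriv n S.m) (iteratedDeriv (n + 1) S.m r) r := by
  rw [iteratedDeriv_succ]
  exact ((S.contDiff_iteratedDeriv n).differentiable (by simp) r).hasDerivAt

theorem hasDerivAt_m (S : TwoSphereOfRevolution) (r : ℝ) : HasDerivAt S.m (deriv S.m r) r :=
  (S.smooth.differentiable (by simp) r).hasDerivAt

theorem iteratedDeriv_m_reflect (n : ℕ) :
    iteratedDeriv n (fun x => S.m (S.a - x)) =
      fun x => (-1) ^ n * iteratedDeriv n S.m (S.a - x) := by
  simpa using iteratedDeriv_comp_const_sub n S.m S.a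

theorem hasDerivAt_deriv_m (S : TwoSphereOfRevolution) (r : ℝ) :
    HasDerivAt (deriv S.m) (iteratedDeriv 2 S.m r) r := by
  have := S.hasDerivAt_iteratedDeriv 1 r
  rwa [iteratedDeriv_one] at this

theorem m_zero (S : TwoSphereOfRevolution) : S.m 0 = 0 := by
  have := S.odd_zero 0
  simp at this
  linarith

theorem m_two_a (S : TwoSphereOfRevolution) : S.m (2 * S.a) = 0 := by
  have := S.odd_two_a 0
  simp at this
  linarith

theorem profile_zero (hm : (fun x => S.m (S.a - x)) =ᶠ[𝓝 0] fun x => ψ (x ^ 2)) : ψ 0 = S.b := by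
  simpa [b] using hm.self_of_nhds.symm

theorem iteratedDeriv_one_reflect (hψ : ContDiffAt ℝ ∞ ψ 0)
    (hm : (fun x => S.m (S.a - x)) =ᶠ[𝓝 0] fun x => ψ (x ^ 2)) :
    (iteratedDeriv 1 fun x => S.m (S.a - x)) =ᶠ[𝓝 0] fun x => deriv ψ (x ^ 2) * (2 * x) := by
  rw [iteratedDeriv_one]
  refine (EventuallyEq.deriv hm).trans ?_
  filter_upwards [eventually_hasDerivAt_comp_sq hψ] with x hx using hx.deriv

theorem iteratedDeriv_two_reflect (hψ : ContDiffAt ℝ ∞ ψ 0)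
    (hm : (fun x => S.m (S.a - x)) =ᶠ[𝓝 0] fun x => ψ (x ^ 2)) :
    (iteratedDeriv 2 fun x => S.m (S.a - x)) =ᶠ[𝓝 0]
      fun x => deriv ψ (x ^ 2) * 2 + deriv (deriv ψ) (x ^ 2) * (4 * x ^ 2) := by
  rw [iteratedDeriv_succ]
  refine (EventuallyEq.deriv (iteratedDeriv_one_reflect hψ hm)).trans ?_
  filter_upwards [eventually_hasDerivAt_comp_sq (contDiffAt_top_deriv hψ)] with x hx
  have := hx.mul ((hasDerivAt_id x).const_mul 2)
  refine (HasDerivAt.deriv this).trans ?_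
  simp only [id]
  ring

theorem iteratedDeriv_three_reflect (hψ : ContDiffAt ℝ ∞ ψ 0)
    (hm : (fun x => S.m (S.a - x)) =ᶠ[𝓝 0] fun x => ψ (x ^ 2)) :
    (iteratedDeriv 3 fun x => S.m (S.a - x)) =ᶠ[𝓝 0]
      fun x => deriv (deriv ψ) (x ^ 2) * (12 * x) +
        deriv (deriv (deriv ψ)) (x ^ 2) * (8 * x ^ 3) := by
  rw [iteratedDeriv_succ]
  refine (EventuallyEq.deriv (iteratedDeriv_two_reflect hψ hm)).trans ?_
  have h1 := contDiffAt_top_deriv hψ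
  filter_upwards [eventually_hasDerivAt_comp_sq h1,
    eventually_hasDerivAt_comp_sq (contDiffAt_top_deriv h1)] with x hx hx'
  have := (hx.mul_const 2).add (hx'.mul ((hasDerivAt_pow 2 x).const_mul 4))
  refine (HasDerivAt.deriv this).trans ?_
  push_cast
  ring

theorem iteratedDeriv_four_reflect (hψ : ContDiffAt ℝ ∞ ψ 0)
    (hm : (fun x => S.m (S.a - x)) =ᶠ[𝓝 0] fun x => ψ (x ^ 2)) :
    iteratedDeriv 4 (fun x => S.m (S.a - x)) 0 = 12 * deriv (deriv ψ) 0 := by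
  rw [iteratedDeriv_succ]
  refine (EventuallyEq.deriv_eq (iteratedDeriv_three_reflect hψ hm)).trans ?_
  have h1 := contDiffAt_top_deriv (contDiffAt_top_deriv hψ)
  have hx := (eventually_hasDerivAt_comp_sq h1).self_of_nhds
  have hx' := (eventually_hasDerivAt_comp_sq (contDiffAt_top_deriv h1)).self_of_nhds
  have := (hx.mul ((hasDerivAt_id (0 : ℝ)).const_mul 12)).add
    (hx'.mul ((hasDerivAt_pow 3 (0 : ℝ)).const_mul 8))
  refine (HasDerivAt.deriv this).trans ?_
  simp
  ring

theorem deriv_profile_zero (hψ : ContDiffAt ℝ ∞ ψ 0)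
    (hm : (fun x => S.m (S.a - x)) =ᶠ[𝓝 0] fun x => ψ (x ^ 2)) : deriv ψ 0 = -S.α := by
  have := (iteratedDeriv_two_reflect hψ hm).self_of_nhds
  rw [iteratedDeriv_m_reflect] at this
  simp at this
  rw [α, this]
  ring

theorem deriv_deriv_profile_zero (hψ : ContDiffAt ℝ ∞ ψ 0)
    (hm : (fun x => S.m (S.a - x)) =ᶠ[𝓝 0] fun x => ψ (x ^ 2)) :
    deriv (deriv ψ) 0 = 2 * S.β := by
  have := iteratedDeriv_four_reflect hψ hm
  rw [iteratedDeriv_m_reflect] at this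
  norm_num at this
  rw [β, this]
  ring

theorem deriv_m_equator (h : S.LocallyReflectionSymmetric) : deriv S.m S.a = 0 := by
  obtain ⟨ψ, hψ, hm⟩ := h.exists_profile
  have := (iteratedDeriv_one_reflect hψ hm).self_of_nhds
  rw [iteratedDeriv_m_reflect] at this
  simpa using this

theorem iteratedDeriv_three_equator (h : S.LocallyReflectionSymmetric) :
    iteratedDeriv 3 S.m S.a = 0 := by
  obtain ⟨ψ, hψ, hm⟩ := h.exists_profile
  have := (iteratedDeriv_three_reflect hψ hm).self_of_nhds
  rw [iteratedDeriv_m_reflect] at this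
  norm_num at this
  exact this

/-! ### The curvature at the equator -/

theorem hasDerivAt_K {r : ℝ} (hr : S.m r ≠ 0) :
    HasDerivAt S.K (-(iteratedDeriv 3 S.m r * S.m r - iteratedDeriv 2 S.m r * deriv S.m r)
      / S.m r ^ 2) r := by
  refine ((S.hasDerivAt_iteratedDeriv 2 r).neg.div (S.hasDerivAt_m r) hr).congr_deriv ?_
  simp only [Pi.neg_apply, Nat.reduceAdd]
  ring

/-- By symmetry `m'` and `m'''` vanish at the equator, so differentiating the quotient for `K'`
leaves `-(m'''' m - m''²)/m²`, with `m'''' = 24β` and `m'' = -2α`. -/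
theorem hasDerivAt_deriv_K (h : S.LocallyReflectionSymmetric) :
    HasDerivAt (deriv S.K) (-(4 * (6 * S.b * S.β - S.α ^ 2)) / S.b ^ 2) S.a := by
  have hb := S.b_pos
  have hb' : S.m S.a ≠ 0 := hb.ne'
  have h1 : deriv S.K =ᶠ[𝓝 S.a] fun r =>
      -(iteratedDeriv 3 S.m r * S.m r - iteratedDeriv 2 S.m r * deriv S.m r) / S.m r ^ 2 := by
    filter_upwards [S.smooth.continuous.continuousAt.eventually_ne hb'] with r hr
    exact (hasDerivAt_K hr).deriv
  refine HasDerivAt.congr_of_eventuallyEq ?_ h1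
  have hd := S.hasDerivAt_deriv_m S.a
  refine (((((S.hasDerivAt_iteratedDeriv 3 S.a).mul (S.hasDerivAt_m S.a)).sub
    ((S.hasDerivAt_iteratedDeriv 2 S.a).mul hd)).neg).div ((S.hasDerivAt_m S.a).pow 2)
    (pow_ne_zero 2 hb')).congr_deriv ?_
  simp only [Pi.neg_apply, Pi.sub_apply, Pi.mul_apply, Pi.pow_apply, Nat.reduceAdd]
  rw [iteratedDeriv_three_equator h, deriv_m_equator h, α, β, b]
  field_simp
  ring

theorem iteratedDeriv_two_K (h : S.LocallyReflectionSymmetric) :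
    iteratedDeriv 2 S.K S.a = -(4 * (6 * S.b * S.β - S.α ^ 2)) / S.b ^ 2 := by
  rw [iteratedDeriv_succ, iteratedDeriv_one]
  exact (hasDerivAt_deriv_K h).deriv

/-- `K'` is nonnegative to the left of `a` and vanishes at `a`, so `K''(a)`, a limit of left slopes
of `K'`, is at most `0`. -/
theorem six_b_β_sub_nonneg (h : S.LocallyReflectionSymmetric) (hK : S.CurvatureMonotone) :
    0 ≤ 6 * S.b * S.β - S.α ^ 2 := by
  have hb := S.b_pos
  have h0 : deriv S.K S.a = 0 := by
    rw [(hasDerivAt_K (S := S) (r := S.a) hb.ne').deriv, iteratedDeriv_three_equator h,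
      deriv_m_equator h]
    simp
  have h1 := (hasDerivAt_iff_tendsto_slope.1 (hasDerivAt_deriv_K h)).mono_left
    (nhdsWithin_mono S.a (fun r (hr : r < S.a) => hr.ne) : 𝓝[<] S.a ≤ 𝓝[≠] S.a)
  have h2 : -(4 * (6 * S.b * S.β - S.α ^ 2)) / S.b ^ 2 ≤ 0 := by
    refine le_of_tendsto h1 ?_
    filter_upwards [Ioo_mem_nhdsLT S.a_pos] with r hr
    have h3 : 0 ≤ deriv S.K r := by
      have hm : S.m r ≠ 0 := (S.pos r ⟨hr.1, by linarith [hr.2, S.a_pos]⟩).ne'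
      have hd := (hasDerivAt_K hm).differentiableAt
      rw [← hd.derivWithin (uniqueDiffWithinAt_Ioo hr)]
      exact (hK.mono Ioo_subset_Ioc_self).derivWithin_nonneg
    rw [slope_def_field, h0, sub_zero]
    exact div_nonpos_of_nonneg_of_nonpos h3 (by linarith [hr.2])
  rw [div_le_iff₀ (by positivity)] at h2
  linarith

/-! ### Consequences of monotone curvature for the profile -/

theorem iteratedDeriv_two_eq {r : ℝ} (hr : r ∈ Ioo 0 (2 * S.a)) :
    iteratedDeriv 2 S.m r = -S.K r * S.m r := by
  have := S.pos r hr
  rw [K]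
  field_simp

/-- Monotonicity of `K` allows two cases. If `K(r) ≤ 0`, then `K ≤ 0` all the way from the pole to
`r`, so `m'` has not decreased from its value `1`. If `K(r) > 0`, then `K > 0` from `r` to the
equator, so `m'` decreases strictly to `0`. -/
theorem deriv_m_pos (h : S.LocallyReflectionSymmetric) (hK : S.CurvatureMonotone) {r : ℝ}
    (hr : r ∈ Ico 0 S.a) : 0 < deriv S.m r := by
  have ha := S.a_pos
  have hcont : Continuous (deriv S.m) :=
    continuous_iff_continuousAt.2 fun r => (S.hasDerivAt_deriv_m r).continuousAt
  rcases hr.1.eq_or_lt with rfl | h0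
  · rw [S.deriv_zero]; exact one_pos
  rcases le_or_gt (S.K r) 0 with hk | hk
  · have hmono : MonotoneOn (deriv S.m) (Icc 0 r) := by
      refine monotoneOn_of_deriv_nonneg (convex_Icc 0 r) hcont.continuousOn
        (fun s _ => (S.hasDerivAt_deriv_m s).differentiableAt.differentiableWithinAt) ?_
      intro s hs
      rw [interior_Icc] at hs
      have hs' : s ∈ Ioo 0 (2 * S.a) := ⟨hs.1, by linarith [hs.2, hr.2]⟩
      rw [(S.hasDerivAt_deriv_m s).deriv, iteratedDeriv_two_eq hs']
      have := hK ⟨hs.1, by linarith [hs.2, hr.2]⟩ ⟨h0, hr.2.le⟩ hs.2.le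
      have := S.pos s hs'
      nlinarith
    have := hmono (left_mem_Icc.2 h0.le) (right_mem_Icc.2 h0.le) h0.le
    rw [S.deriv_zero] at this
    linarith
  · have hanti : StrictAntiOn (deriv S.m) (Icc r S.a) := by
      refine strictAntiOn_of_deriv_neg (convex_Icc r S.a) hcont.continuousOn ?_
      intro s hs
      rw [interior_Icc] at hs
      have hs' : s ∈ Ioo 0 (2 * S.a) := ⟨by linarith [hs.1], by linarith [hs.2, hr.2]⟩
      rw [(S.hasDerivAt_deriv_m s).deriv, iteratedDeriv_two_eq hs']
      have := hK ⟨h0, hr.2.le⟩ ⟨hs'.1, hs.2.le⟩ hs.1.le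
      have := S.pos s hs'
      nlinarith
    have := hanti (left_mem_Icc.2 hr.2.le) (right_mem_Icc.2 hr.2.le) hr.2
    rwa [deriv_m_equator h] at this

theorem strictMonoOn_m (h : S.LocallyReflectionSymmetric) (hK : S.CurvatureMonotone) :
    StrictMonoOn S.m (Icc 0 S.a) := by
  refine strictMonoOn_of_deriv_pos (convex_Icc 0 S.a) S.smooth.continuous.continuousOn ?_
  intro r hr
  rw [interior_Icc] at hr
  exact deriv_m_pos h hK ⟨hr.1.le, hr.2⟩

/-- Comparison with the sphere of curvature `k = K(a)`: the quantity `m'² + k m²` has derivative `2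
m' m (k - K) ≥ 0`, and it equals `1` at the pole and `k b² = 2αb` at the equator. -/
theorem one_le_two_α_b (h : S.LocallyReflectionSymmetric) (hK : S.CurvatureMonotone) :
    1 ≤ 2 * S.α * S.b := by
  have hb := S.b_pos
  have ha := S.a_pos
  set k := S.K S.a with hk
  have hkα : k = 2 * S.α / S.b := by
    rw [hk, K, α, b]; ring
  have hder : ∀ r, HasDerivAt (fun r => deriv S.m r ^ 2 + k * S.m r ^ 2)
      (2 * deriv S.m r * (iteratedDeriv 2 S.m r + k * S.m r)) r := by
    intro r
    have := ((S.hasDerivAt_deriv_m r).pow 2).add (((S.hasDerivAt_m r).pow 2).const_mul k)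
    refine this.congr_deriv ?_
    push_cast
    ring
  have hmono : MonotoneOn (fun r => deriv S.m r ^ 2 + k * S.m r ^ 2) (Icc 0 S.a) := by
    refine monotoneOn_of_deriv_nonneg (convex_Icc 0 S.a)
      (fun r _ => (hder r).continuousAt.continuousWithinAt)
      (fun r _ => (hder r).differentiableAt.differentiableWithinAt) ?_
    intro r hr
    rw [interior_Icc] at hr
    have hr' : r ∈ Ioo 0 (2 * S.a) := ⟨hr.1, by linarith [hr.2]⟩
    rw [(hder r).deriv, iteratedDeriv_two_eq hr']
    have h1 := deriv_m_pos h hK ⟨hr.1.le, hr.2⟩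
    have h2 := hK ⟨hr.1, hr.2.le⟩ ⟨ha, le_rfl⟩ hr.2.le
    have h3 := S.pos r hr'
    have : 0 ≤ (k - S.K r) * S.m r := mul_nonneg (sub_nonneg.2 h2) h3.le
    have : 0 ≤ 2 * deriv S.m r * ((k - S.K r) * S.m r) := by positivity
    linarith
  have := hmono (left_mem_Icc.2 ha.le) (right_mem_Icc.2 ha.le) ha.le
  simp only [S.deriv_zero, S.m_zero, deriv_m_equator h] at this
  change _ ≤ 0 ^ 2 + k * S.b ^ 2 at this
  rw [hkα] at this
  field_simp at this
  exact le_of_mul_le_mul_left (by linarith : S.b * 1 ≤ S.b * (2 * S.α * S.b)) hb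

theorem α_pos (h : S.LocallyReflectionSymmetric) (hK : S.CurvatureMonotone) : 0 < S.α := by
  have h1 := one_le_two_α_b h hK
  have hb := S.b_pos
  by_contra h2
  push Not at h2
  nlinarith

theorem cubicConst_nonneg (h : S.LocallyReflectionSymmetric) (hK : S.CurvatureMonotone) :
    0 ≤ S.cubicConst := by
  have h1 := six_b_β_sub_nonneg h hK
  have h2 := α_pos h hK
  have h3 := Real.pi_pos
  rw [cubicConst]
  positivity

theorem cubicConst_pos (h : S.LocallyReflectionSymmetric) (hK : S.CurvatureMonotone)
    (h0 : iteratedDeriv 2 S.K S.a ≠ 0) : 0 < S.cubicConst := by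
  have h1 : 0 < 6 * S.b * S.β - S.α ^ 2 := by
    refine (six_b_β_sub_nonneg h hK).lt_of_ne fun h1 => h0 ?_
    rw [iteratedDeriv_two_K h, ← h1]
    simp
  have h2 := α_pos h hK
  have h3 := Real.pi_pos
  have h4 := S.b_pos
  rw [cubicConst]
  positivity


/-! ### A chart adapted to the equator -/

/-- With `x = a - r`, near the equator `m = b - x² χ(x²)` and `m' = 2 x D(x²)`, and the signed root
`x √χ(x²)` of `b - m` has the continuous derivative `D(x²) / √χ(x²)`. -/
structure EquatorialChart (S : TwoSphereOfRevolution) (χ D : ℝ → ℝ) (ε : ℝ) : Prop where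
  eps_pos : 0 < ε
  m_eq : ∀ x, |x| < ε → S.m (S.a - x) = S.b - x ^ 2 * χ (x ^ 2)
  deriv_eq : ∀ x, |x| < ε → deriv S.m (S.a - x) = 2 * x * D (x ^ 2)
  χ_pos : ∀ x, |x| < ε → S.α / 2 < χ (x ^ 2)
  D_pos : ∀ x, |x| < ε → 0 < D (x ^ 2)
  root_deriv : ∀ x, |x| < ε →
    HasDerivAt (fun x => x * √(χ (x ^ 2))) (D (x ^ 2) / √(χ (x ^ 2))) x
  root_cont : ContinuousOn (fun x => D (x ^ 2) / √(χ (x ^ 2))) (Ioo (-ε) ε)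
  χ_taylor : (fun z => χ z - (S.α - S.β * z)) =O[𝓝 0] fun z => z ^ 2
  D_taylor : (fun z => D z - (S.α - 2 * S.β * z)) =O[𝓝 0] fun z => z ^ 2

variable {S : TwoSphereOfRevolution} {ψ : ℝ → ℝ}

theorem profile_eq_dslope (hm : (fun x => S.m (S.a - x)) =ᶠ[𝓝 0] fun x => ψ (x ^ 2)) (z : ℝ) :
    ψ z = S.b - z * -dslope ψ 0 z := by
  have := sub_smul_dslope ψ 0 z
  rw [profile_zero hm, smul_eq_mul, sub_zero] at this
  linarith

theorem deriv_profile_taylor (hψ : ContDiffAt ℝ ∞ ψ 0)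
    (hm : (fun x => S.m (S.a - x)) =ᶠ[𝓝 0] fun x => ψ (x ^ 2)) :
    (fun z => -deriv ψ z - (S.α - 2 * S.β * z)) =O[𝓝 0] fun z => z ^ 2 := by
  have h1 : ContDiffAt ℝ 2 (deriv ψ) 0 := (contDiffAt_top_deriv hψ).of_le (by norm_cast)
  have := h1.isBigO_sub_taylor_one.neg_left
  simp only [sub_zero] at this
  refine this.congr_left fun z => ?_
  rw [deriv_profile_zero hψ hm, deriv_deriv_profile_zero hψ hm]
  ring

/-- Integrating the expansion of `ψ'` gives `b - ψ` up to `O(z³)`; dividing by `z` gives the claim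
away from `0`, where the slope is `ψ'(0)` instead. -/
theorem dslope_profile_taylor (hψ : ContDiffAt ℝ ∞ ψ 0)
    (hm : (fun x => S.m (S.a - x)) =ᶠ[𝓝 0] fun x => ψ (x ^ 2)) :
    (fun z => -dslope ψ 0 z - (S.α - S.β * z)) =O[𝓝 0] fun z => z ^ 2 := by
  have h1 : (fun z => -ψ z + S.b - (S.α * z - S.β * z ^ 2)) =O[𝓝 0] fun z => (z - 0) ^ (2 + 1) := by
    refine isBigO_pow_succ_of_hasDerivAt
      (f' := fun z => -deriv ψ z - (S.α - 2 * S.β * z)) ?_ ?_ ?_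
    · filter_upwards [eventually_hasDerivAt_of_contDiffAt hψ] with z hz
      have := (hz.neg.add_const S.b).sub
        (((hasDerivAt_id z).const_mul S.α).sub ((hasDerivAt_pow 2 z).const_mul S.β))
      refine this.congr_deriv ?_
      push_cast
      ring
    · simp [profile_zero hm]
    · simpa using deriv_profile_taylor hψ hm
  obtain ⟨C, hC⟩ := h1.bound
  refine IsBigO.of_bound C ?_
  filter_upwards [hC] with z hz
  rcases eq_or_ne z 0 with rfl | h0
  · simp [deriv_profile_zero hψ hm]
  · have h2 : -ψ z + S.b - (S.α * z - S.β * z ^ 2)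
        = z * (-dslope ψ 0 z - (S.α - S.β * z)) := by
      rw [profile_eq_dslope hm z]; ring
    rw [h2, norm_mul, sub_zero, pow_succ, norm_mul] at hz
    have h3 : 0 < ‖z‖ := norm_pos_iff.2 h0
    refine le_of_mul_le_mul_left ?_ h3
    linarith

/-- The functions are `χ = -dslope ψ 0` and `D = -ψ'`. From `b - ψ = z χ` follows `χ + z χ' = D`,
and this is why the derivative of `x √χ(x²)` is `D/√χ`. -/
theorem LocallyReflectionSymmetric.exists_chart (h : S.LocallyReflectionSymmetric) (hα : 0 < S.α) :
    ∃ χ D : ℝ → ℝ, ∃ ε, S.EquatorialChart χ D ε := by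
  obtain ⟨ψ, hψ, hm⟩ := h.exists_profile
  have hb := S.b_pos
  set χ : ℝ → ℝ := fun z => -dslope ψ 0 z with hχ
  have hψd := eventually_hasDerivAt_of_contDiffAt hψ
  have hχ0 : χ 0 = S.α := by simp [hχ, deriv_profile_zero hψ hm]
  have hχc : ContinuousAt χ 0 :=
    (continuousAt_dslope_same.2 hψd.self_of_nhds.differentiableAt).neg
  have hχc' : ∀ᶠ z in 𝓝 (0 : ℝ), ContinuousAt χ z := by
    filter_upwards [hψd] with z hz
    rcases eq_or_ne z 0 with rfl | h0
    · exact hχc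
    · exact ((continuousAt_dslope_of_ne h0).2 hz.continuousAt).neg
  have hDc' : ∀ᶠ z in 𝓝 (0 : ℝ), ContinuousAt (fun z => -deriv ψ z) z := by
    filter_upwards [eventually_hasDerivAt_of_contDiffAt (contDiffAt_top_deriv hψ)] with z hz
    exact hz.continuousAt.neg
  have e1 : ∀ᶠ z in 𝓝 (0 : ℝ), S.α / 2 < χ z :=
    hχc.eventually_const_lt (by rw [hχ0]; linarith)
  have e2 : ∀ᶠ z in 𝓝 (0 : ℝ), 0 < -deriv ψ z :=
    hDc'.self_of_nhds.eventually_const_lt (by simp only [deriv_profile_zero hψ hm]; linarith)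
  have e4 : ∀ᶠ x in 𝓝 (0 : ℝ), deriv S.m (S.a - x) = 2 * x * -deriv ψ (x ^ 2) := by
    filter_upwards [iteratedDeriv_one_reflect hψ hm] with x hx
    rw [iteratedDeriv_m_reflect] at hx
    simp only [pow_one, iteratedDeriv_one] at hx
    linarith
  have e5 : ∀ᶠ x in 𝓝 (0 : ℝ),
      HasDerivAt (fun x => x * √(χ (x ^ 2))) (-deriv ψ (x ^ 2) / √(χ (x ^ 2))) x := by
    filter_upwards [tendsto_sq_zero.eventually hχc', tendsto_sq_zero.eventually e1,
      tendsto_sq_zero.eventually hψd] with x hx1 hx2 hx3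
    have hpos : 0 < χ (x ^ 2) := by linarith
    -- At `x = 0` no derivative of `χ` is needed: the difference quotient of `x √χ(x²)` is `√χ(x²)`
    -- itself, and continuity suffices.
    rcases eq_or_ne x 0 with rfl | h0
    · rw [hasDerivAt_iff_tendsto_slope]
      have h1 : Tendsto (fun x : ℝ => √(χ (x ^ 2))) (𝓝[≠] 0) (𝓝 (√(χ (0 ^ 2)))) := by
        have h2 : ContinuousAt (fun x : ℝ => √(χ (x ^ 2))) 0 :=
          (ContinuousAt.comp (f := fun x : ℝ => x ^ 2) hx1 (by fun_prop)).sqrt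
        exact h2.tendsto.mono_left nhdsWithin_le_nhds
      have h3 : -deriv ψ (0 ^ 2) / √(χ (0 ^ 2)) = √(χ (0 ^ 2)) := by
        have : (0 : ℝ) ^ 2 = 0 := by simp
        rw [this, hχ0, deriv_profile_zero hψ hm, neg_neg, Real.div_sqrt]
      rw [h3]
      refine h1.congr' ?_
      filter_upwards [self_mem_nhdsWithin] with y hy
      have hy' : y ≠ 0 := hy
      rw [slope_def_field]
      field_simp
      ring
    · have hz0 : x ^ 2 ≠ 0 := pow_ne_zero 2 h0
      have h1 : HasDerivAt χ ((-deriv ψ (x ^ 2) - χ (x ^ 2)) / x ^ 2) (x ^ 2) := by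
        have h2 : HasDerivAt (fun z => (S.b - ψ z) / z)
            ((-deriv ψ (x ^ 2) * x ^ 2 - (S.b - ψ (x ^ 2)) * 1) / (x ^ 2) ^ 2) (x ^ 2) :=
          (hx3.const_sub S.b).div (hasDerivAt_id _) hz0
        have h3 : χ =ᶠ[𝓝 (x ^ 2)] fun z => (S.b - ψ z) / z := by
          filter_upwards [eventually_ne_nhds hz0] with z hz
          rw [profile_eq_dslope hm z]
          field_simp
          simp [hχ, mul_comm]
        refine (h2.congr_of_eventuallyEq h3).congr_deriv ?_
        rw [profile_eq_dslope hm (x ^ 2)]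
        simp only [hχ]
        field_simp
        ring
      have hsq : HasDerivAt (fun x : ℝ => x ^ 2) (2 * x) x := by simpa using hasDerivAt_pow 2 x
      have h4 : HasDerivAt (fun x => χ (x ^ 2)) _ x :=
        HasDerivAt.comp (h₂ := χ) (h := fun x : ℝ => x ^ 2) x h1 hsq
      have h5 := (hasDerivAt_id x).mul (h4.sqrt hpos.ne')
      refine h5.congr_deriv ?_
      have hs : 0 < √(χ (x ^ 2)) := Real.sqrt_pos.2 hpos
      have hs2 := Real.sq_sqrt hpos.le
      simp only [id]
      field_simp
      rw [hs2]
      ring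
  obtain ⟨ε, hε, hball⟩ := Metric.eventually_nhds_iff_ball.1
    (hm.and (e4.and (e5.and ((tendsto_sq_zero.eventually e1).and
      ((tendsto_sq_zero.eventually e2).and ((tendsto_sq_zero.eventually hχc').and
        (tendsto_sq_zero.eventually hDc')))))))
  have hB : ∀ x, |x| < ε → x ∈ Metric.ball (0 : ℝ) ε := fun x hx => by simpa using hx
  refine ⟨χ, fun z => -deriv ψ z, ε, hε, fun x hx => ?_, fun x hx => ?_, fun x hx => ?_,
    fun x hx => ?_, fun x hx => ?_, fun x hx => ?_,
    dslope_profile_taylor hψ hm, deriv_profile_taylor hψ hm⟩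
  · exact ((hball x (hB x hx)).1).trans (profile_eq_dslope hm _)
  · exact (hball x (hB x hx)).2.1
  · exact (hball x (hB x hx)).2.2.2.1
  · exact (hball x (hB x hx)).2.2.2.2.1
  · exact (hball x (hB x hx)).2.2.1
  · obtain ⟨-, -, -, h1, -, h2, h3⟩ := hball x (hB x (abs_lt.2 hx))
    have hpos : 0 < χ (x ^ 2) := by linarith
    have h2' : ContinuousAt (fun x : ℝ => χ (x ^ 2)) x :=
      ContinuousAt.comp (f := fun x : ℝ => x ^ 2) h2 (by fun_prop)
    have h3' : ContinuousAt (fun x : ℝ => -deriv ψ (x ^ 2)) x :=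
      ContinuousAt.comp (f := fun x : ℝ => x ^ 2) h3 (by fun_prop)
    exact (h3'.div h2'.sqrt (Real.sqrt_pos.2 hpos).ne').continuousWithinAt


/-! ### Geodesics through the equator -/

variable {S : TwoSphereOfRevolution}

namespace IsEquatorGeodesic

variable {η : ℝ} {c : ℝ → ℝ × ℝ}

theorem hasDerivAt_r (h : S.IsEquatorGeodesic η c) (t : ℝ) :
    HasDerivAt (fun t => (c t).1) (deriv (fun t => (c t).1) t) t :=
  (h.geodesic.smooth_r.differentiable (by simp) t).hasDerivAt

theorem hasDerivAt_θ (h : S.IsEquatorGeodesic η c) (t : ℝ) :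
    HasDerivAt (fun t => (c t).2) (deriv (fun t => (c t).2) t) t :=
  (h.geodesic.smooth_θ.differentiable (by simp) t).hasDerivAt

theorem hasDerivAt_deriv_r (h : S.IsEquatorGeodesic η c) (t : ℝ) :
    HasDerivAt (deriv fun t => (c t).1)
      (S.m (c t).1 * deriv S.m (c t).1 * deriv (fun t => (c t).2) t ^ 2) t := by
  rw [← h.geodesic.eq_r t]
  exact ((contDiff_infty_iff_deriv.1 h.geodesic.smooth_r).2.differentiable (by simp) t).hasDerivAt

theorem hasDerivAt_deriv_θ (h : S.IsEquatorGeodesic η c) (t : ℝ) :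
    HasDerivAt (deriv fun t => (c t).2) (-2 * (deriv S.m (c t).1 / S.m (c t).1) *
      deriv (fun t => (c t).1) t * deriv (fun t => (c t).2) t) t := by
  rw [← h.geodesic.eq_θ t]
  exact ((contDiff_infty_iff_deriv.1 h.geodesic.smooth_θ).2.differentiable (by simp) t).hasDerivAt

theorem m_pos (h : S.IsEquatorGeodesic η c) (t : ℝ) : 0 < S.m (c t).1 :=
  S.pos _ (h.geodesic.mem t)

theorem hasDerivAt_m_comp (h : S.IsEquatorGeodesic η c) (t : ℝ) :
    HasDerivAt (fun t => S.m (c t).1) (deriv S.m (c t).1 * deriv (fun t => (c t).1) t) t :=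
  HasDerivAt.comp (h := fun t => (c t).1) t (S.hasDerivAt_m (c t).1) (h.hasDerivAt_r t)

theorem eq_of_hasDerivAt_zero {f : ℝ → ℝ} (hf : ∀ t, HasDerivAt f 0 t) (t : ℝ) : f t = f 0 :=
  is_const_of_deriv_eq_zero (fun t => (hf t).differentiableAt) (fun t => (hf t).deriv) t 0

/-- The Clairaut relation. -/
theorem deriv_θ (h : S.IsEquatorGeodesic η c) (t : ℝ) :
    deriv (fun t => (c t).2) t = S.b * Real.cos η / S.m (c t).1 ^ 2 := by
  have hconst := eq_of_hasDerivAt_zero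
    (f := fun t => S.m (c t).1 ^ 2 * deriv (fun t => (c t).2) t) (fun t => by
      refine (((h.hasDerivAt_m_comp t).pow 2).mul (h.hasDerivAt_deriv_θ t)).congr_deriv ?_
      have := (h.m_pos t).ne'
      simp only [Pi.pow_apply]
      push_cast
      field_simp
      ring) t
  have h0 : (c 0).1 = S.a := by rw [h.start]
  simp only [h.velocity_θ, h0] at hconst
  change _ = S.b ^ 2 * _ at hconst
  have := (h.m_pos t).ne'
  have := S.b_pos.ne'
  rw [eq_div_iff (by positivity), mul_comm, hconst]
  field_simp

theorem energy (h : S.IsEquatorGeodesic η c) (t : ℝ) :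
    S.m (c t).1 ^ 2 * deriv (fun t => (c t).1) t ^ 2
      = S.m (c t).1 ^ 2 - (S.b * Real.cos η) ^ 2 := by
  have hconst := eq_of_hasDerivAt_zero (f := fun t => deriv (fun t => (c t).1) t ^ 2
      + S.m (c t).1 ^ 2 * deriv (fun t => (c t).2) t ^ 2) (fun t => by
      refine (((h.hasDerivAt_deriv_r t).pow 2).add
        (((h.hasDerivAt_m_comp t).pow 2).mul ((h.hasDerivAt_deriv_θ t).pow 2))).congr_deriv ?_
      have := (h.m_pos t).ne'
      simp only [Pi.pow_apply]
      push_cast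
      field_simp
      ring) t
  have h0 : (c 0).1 = S.a := by rw [h.start]
  simp only [h.velocity_r, h.velocity_θ, h0, h.deriv_θ t] at hconst
  change _ = _ + S.b ^ 2 * _ at hconst
  have h1 := (h.m_pos t).ne'
  have h2 := S.b_pos.ne'
  have h3 : deriv (fun t => (c t).1) t ^ 2 + S.m (c t).1 ^ 2
      * (S.b * Real.cos η / S.m (c t).1 ^ 2) ^ 2 = 1 := by
    rw [hconst, ← Real.sin_sq_add_cos_sq η]
    field_simp
  field_simp at h3
  linarith

theorem clairaut_pos (hη : η ∈ Ioo (-(Real.pi / 2)) (Real.pi / 2)) : 0 < S.b * Real.cos η :=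
  mul_pos S.b_pos (Real.cos_pos_of_mem_Ioo hη)

theorem clairaut_le_m (h : S.IsEquatorGeodesic η c) (t : ℝ) : S.b * Real.cos η ≤ S.m (c t).1 := by
  refine abs_le_of_sq_le_sq' ?_ (h.m_pos t).le |>.2
  have := h.energy t
  nlinarith [sq_nonneg (S.m (c t).1 * deriv (fun t => (c t).1) t)]

/-- To leave the strip the geodesic would have to meet a parallel `|a - r| = δ`; there `m < b - δ²
α/2 < b cos η`, against the Clairaut bound `b cos η ≤ m`. -/
theorem abs_lt_of_chart {χ D : ℝ → ℝ} {ε δ : ℝ} (hch : S.EquatorialChart χ D ε)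
    (h : S.IsEquatorGeodesic η c) (hδ : 0 < δ) (hδε : δ < ε)
    (hη : S.b - S.b * Real.cos η < S.α / 2 * δ ^ 2) (t : ℝ) : |S.a - (c t).1| < δ := by
  by_contra hcon
  push Not at hcon
  have hcont : Continuous fun t => |S.a - (c t).1| :=
    (continuous_const.sub h.geodesic.smooth_r.continuous).abs
  have h0 : |S.a - (c 0).1| = 0 := by simp [h.start]
  obtain ⟨s, -, hs⟩ : δ ∈ (fun t => |S.a - (c t).1|) '' univ := by
    refine isPreconnected_univ.intermediate_value (mem_univ 0) (mem_univ t) hcont.continuousOn ?_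
    exact ⟨by simp only [h0]; exact hδ.le, hcon⟩
  have h1 := hch.m_eq (S.a - (c s).1) (by simpa only [hs] using hδε)
  have h2 := hch.χ_pos (S.a - (c s).1) (by simpa only [hs] using hδε)
  have h3 : (S.a - (c s).1) ^ 2 = δ ^ 2 := by rw [← sq_abs]; simp only [hs]
  rw [h3] at h1 h2
  rw [sub_sub_cancel] at h1
  have h4 := h.clairaut_le_m s
  have : 0 < δ ^ 2 := by positivity
  nlinarith

/-- The speed of the angle variable of a geodesic. -/
noncomputable def _root_.TwoSphereOfRevolution.angleSpeed (S : TwoSphereOfRevolution) (χ D : ℝ → ℝ) (ν r : ℝ) :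
    ℝ :=
  D ((S.a - r) ^ 2) / √(χ ((S.a - r) ^ 2)) * (√(S.m r + ν) / S.m r)

/-- Near the equator the geodesics are harmonic oscillations in terms of an angle variable. -/
theorem exists_angle {χ D : ℝ → ℝ} {ε : ℝ} (hα : 0 < S.α) (hch : S.EquatorialChart χ D ε)
    (h : S.IsEquatorGeodesic η c) (hη : η ∈ Ioo (-(Real.pi / 2)) (Real.pi / 2))
    (hx : ∀ t, |S.a - (c t).1| < ε) :
    ∃ τ : ℝ → ℝ, τ 0 = 0 ∧
      (∀ t, HasDerivAt τ (S.angleSpeed χ D (S.b * Real.cos η) (c t).1) t) ∧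
      (∀ t, (S.a - (c t).1) * √(χ ((S.a - (c t).1) ^ 2))
        = √(2 * S.b) * Real.sin (η / 2) * Real.sin (τ t)) ∧
      (∀ t, -deriv (fun t => (c t).1) t * S.m (c t).1 / √(S.m (c t).1 + S.b * Real.cos η)
        = √(2 * S.b) * Real.sin (η / 2) * Real.cos (τ t)) := by
  set ν := S.b * Real.cos η with hν
  have hν0 : 0 < ν := clairaut_pos hη
  have hb := S.b_pos
  set ρ := √(2 * S.b) * Real.sin (η / 2) with hρ
  have hrc : Continuous fun t => (c t).1 := h.geodesic.smooth_r.continuous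
  have hspeed : Continuous fun t => S.angleSpeed χ D ν (c t).1 := by
    have h1 : Continuous fun t => D ((S.a - (c t).1) ^ 2) / √(χ ((S.a - (c t).1) ^ 2)) :=
      hch.root_cont.comp_continuous (f := fun t => S.a - (c t).1) (continuous_const.sub hrc)
        fun t => abs_lt.1 (hx t)
    have h2 : Continuous fun t => S.m (c t).1 := S.smooth.continuous.comp hrc
    exact h1.mul (((h2.add_const ν).sqrt).div h2 fun t => (h.m_pos t).ne')
  set τ : ℝ → ℝ := fun t => ∫ s in (0 : ℝ)..t, S.angleSpeed χ D ν (c s).1 with hτ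
  have hτd : ∀ t, HasDerivAt τ (S.angleSpeed χ D ν (c t).1) t := fun t =>
    intervalIntegral.integral_hasDerivAt_right (hspeed.intervalIntegrable _ _)
      (hspeed.stronglyMeasurableAtFilter _ _) hspeed.continuousAt
  have hτ0 : τ 0 = 0 := by simp [hτ]
  have hu : ∀ t, HasDerivAt (fun t => (S.a - (c t).1) * √(χ ((S.a - (c t).1) ^ 2)))
      (-deriv (fun t => (c t).1) t * S.m (c t).1 / √(S.m (c t).1 + ν)
        * S.angleSpeed χ D ν (c t).1) t := by
    intro t
    have h1 := hch.root_deriv _ (hx t)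
    have h2 := HasDerivAt.comp (h := fun t => S.a - (c t).1) t h1 ((h.hasDerivAt_r t).const_sub S.a)
    refine h2.congr_deriv ?_
    have h3 := h.m_pos t
    have h4 : 0 < √(S.m (c t).1 + ν) := Real.sqrt_pos.2 (by linarith)
    rw [angleSpeed]
    field_simp
  -- Together with `hu` this is the rotation system `u' = w τ'`, `w' = -u τ'`; the energy identity
  -- eliminates `r'²`.
  have hw : ∀ t, HasDerivAt
      (fun t => -deriv (fun t => (c t).1) t * S.m (c t).1 / √(S.m (c t).1 + ν))
      (-((S.a - (c t).1) * √(χ ((S.a - (c t).1) ^ 2)) * S.angleSpeed χ D ν (c t).1)) t := by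
    intro t
    have h3 := h.m_pos t
    have h3' : 0 < S.m (c t).1 + ν := by linarith
    have h4 : 0 < √(S.m (c t).1 + ν) := Real.sqrt_pos.2 h3'
    have h1 := ((h.hasDerivAt_deriv_r t).neg.mul (h.hasDerivAt_m_comp t)).div
      (((h.hasDerivAt_m_comp t).add_const ν).sqrt h3'.ne') h4.ne'
    refine h1.congr_deriv ?_
    have h5 : 0 < √(χ ((S.a - (c t).1) ^ 2)) :=
      Real.sqrt_pos.2 (by linarith [hch.χ_pos _ (hx t)])
    have h6 := hch.deriv_eq _ (hx t)
    rw [sub_sub_cancel] at h6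
    have h7 : (S.a - (c t).1) * √(χ ((S.a - (c t).1) ^ 2)) * S.angleSpeed χ D ν (c t).1
        = deriv S.m (c t).1 * √(S.m (c t).1 + ν) / (2 * S.m (c t).1) := by
      rw [h6, angleSpeed]
      field_simp
    rw [h7, h.deriv_θ t]
    have h8 := h.energy t
    have h9 := Real.sq_sqrt h3'.le
    simp only [Pi.neg_apply, Pi.mul_apply, ← hν] at h8 ⊢
    generalize deriv S.m (c t).1 = M' at *
    generalize deriv (fun t => (c t).1) t = R at *
    generalize hM : S.m (c t).1 = M at *
    generalize √(M + ν) = s at *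
    field_simp
    rw [show s ^ 4 = (s ^ 2) ^ 2 by ring, h9]
    linear_combination M' * (-M - 2 * ν) * h8
  have h0 : (c 0).1 = S.a := by rw [h.start]
  -- Half angle formulas: `b + ν = 2b cos²(η/2)` and `sin η = 2 sin(η/2) cos(η/2)`.
  have hw0 : -deriv (fun t => (c t).1) 0 * S.m (c 0).1 / √(S.m (c 0).1 + ν) = ρ := by
    rw [h.velocity_r, h0]
    change _ * S.b / √(S.b + ν) = _
    have hc : 0 < Real.cos (η / 2) := Real.cos_pos_of_mem_Ioo
      ⟨by linarith [hη.1, Real.pi_pos], by linarith [hη.2, Real.pi_pos]⟩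
    have h1 : S.b + ν = (√(2 * S.b) * Real.cos (η / 2)) ^ 2 := by
      rw [mul_pow, Real.sq_sqrt (by positivity), Real.cos_sq, hν]
      have : 2 * (η / 2) = η := by ring
      rw [this]
      ring
    have hs : 0 < √(2 * S.b) := Real.sqrt_pos.2 (by positivity)
    have hs2 := Real.sq_sqrt (by positivity : 0 ≤ 2 * S.b)
    rw [h1, Real.sqrt_sq (by positivity), hρ, neg_neg, div_eq_iff (by positivity)]
    have h2 : Real.sin η = 2 * Real.sin (η / 2) * Real.cos (η / 2) := by
      rw [← Real.sin_two_mul]; congr 1; ring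
    rw [h2]
    linear_combination (-Real.sin (η / 2) * Real.cos (η / 2)) * hs2
  -- `(u, w)` and `(ρ sin τ, ρ cos τ)` solve the same rotation system with the same initial value.
  -- Their squared distance is constant, hence zero.
  have hD := eq_of_hasDerivAt_zero (f := fun t =>
    ((S.a - (c t).1) * √(χ ((S.a - (c t).1) ^ 2)) - ρ * Real.sin (τ t)) ^ 2 +
    (-deriv (fun t => (c t).1) t * S.m (c t).1 / √(S.m (c t).1 + ν) - ρ * Real.cos (τ t)) ^ 2)
    (fun t => by
      have hA := (hu t).sub ((hτd t).sin.const_mul ρ)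
      have hB := (hw t).sub ((hτd t).cos.const_mul ρ)
      refine ((hA.pow 2).add (hB.pow 2)).congr_deriv ?_
      simp only [Pi.sub_apply]
      push_cast
      ring)
  have hD0 : ∀ t, ((S.a - (c t).1) * √(χ ((S.a - (c t).1) ^ 2)) - ρ * Real.sin (τ t)) ^ 2 +
    (-deriv (fun t => (c t).1) t * S.m (c t).1 / √(S.m (c t).1 + ν) - ρ * Real.cos (τ t)) ^ 2
      = 0 := by
    intro t
    refine (hD t).trans ?_
    rw [hw0, hτ0, h0]
    simp
  refine ⟨τ, hτ0, hτd, fun t => ?_, fun t => ?_⟩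
  · have := hD0 t
    nlinarith [sq_nonneg (-deriv (fun t => (c t).1) t * S.m (c t).1 / √(S.m (c t).1 + ν)
      - ρ * Real.cos (τ t))]
  · have := hD0 t
    nlinarith

end IsEquatorGeodesic


/-! ### Estimates of the Riemannian distance -/

variable {S : TwoSphereOfRevolution}

theorem curveLength_nonneg (u v : ℝ → ℝ) : 0 ≤ S.curveLength u v :=
  intervalIntegral.integral_nonneg zero_le_one fun _ _ => Real.sqrt_nonneg _

theorem abs_sub_le_curveLength {u v g g' : ℝ → ℝ} {C : ℝ} (hu : ContDiff ℝ 1 u)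
    (hv : ContDiff ℝ 1 v) (hg : ∀ t, HasDerivAt g (g' t) t) (hg' : Continuous g')
    (hC : ∀ t ∈ Icc (0 : ℝ) 1, |g' t| ≤ C * √(deriv u t ^ 2 + S.m (u t) ^ 2 * deriv v t ^ 2)) :
    |g 0 - g 1| ≤ C * S.curveLength u v := by
  have hcont : Continuous fun t => C * √(deriv u t ^ 2 + S.m (u t) ^ 2 * deriv v t ^ 2) := by
    have h1 : Continuous (deriv u) := hu.continuous_deriv le_rfl
    have h2 : Continuous (deriv v) := hv.continuous_deriv le_rfl
    have h3 : Continuous fun t => S.m (u t) := S.smooth.continuous.comp hu.continuous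
    fun_prop
  rw [abs_sub_comm, ← intervalIntegral.integral_eq_sub_of_hasDerivAt (fun t _ => hg t)
    (hg'.intervalIntegrable 0 1), curveLength, ← intervalIntegral.integral_const_mul]
  rw [← Real.norm_eq_abs]
  refine intervalIntegral.norm_integral_le_of_norm_le zero_le_one ?_ (hcont.intervalIntegrable 0 1)
  filter_upwards with t ht using hC t (Ioc_subset_Icc_self ht)

theorem JoinedBy.nonneg {P Q : ℝ × ℝ} {L : ℝ} (h : S.JoinedBy P Q L) : 0 ≤ L := by
  induction h with
  | curve u v => exact curveLength_nonneg u v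
  | same => exact le_rfl
  | trans _ _ _ _ _ _ _ h1 h2 => exact add_nonneg h1 h2

theorem rdist_nonneg (P Q : ℝ × ℝ) : 0 ≤ S.rdist P Q :=
  Real.sInf_nonneg fun _ h => JoinedBy.nonneg h

theorem bddBelow_lengths (P Q : ℝ × ℝ) : BddBelow {L | S.JoinedBy P Q L} :=
  ⟨0, fun _ h => JoinedBy.nonneg h⟩

/-- Paths may switch between coordinates of the same point, so a test function must not distinguish
such coordinates; its variation then adds up over the pieces. -/
theorem JoinedBy.abs_sub_le {f : ℝ × ℝ → ℝ} {C : ℝ}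
    (hsame : ∀ P Q, S.SamePoint P Q → f P = f Q)
    (hcurve : ∀ u v : ℝ → ℝ, ContDiff ℝ 1 u → ContDiff ℝ 1 v →
      (∀ t ∈ Icc (0 : ℝ) 1, u t ∈ Icc 0 (2 * S.a)) →
      |f (u 0, v 0) - f (u 1, v 1)| ≤ C * S.curveLength u v)
    {P Q : ℝ × ℝ} {L : ℝ} (h : S.JoinedBy P Q L) : |f P - f Q| ≤ C * L := by
  induction h with
  | curve u v hu hv hmem => exact hcurve u v hu hv hmem
  | same P Q h => simp [hsame P Q h]
  | trans P Q R L L' _ _ h1 h2 =>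
    rw [mul_add]
    exact (_root_.abs_sub_le _ (f Q) _).trans (add_le_add h1 h2)

theorem joinedBy_meridian_parallel {r r' θ θ' : ℝ} (hr : r ∈ Icc 0 (2 * S.a))
    (hr' : r' ∈ Icc 0 (2 * S.a)) :
    S.JoinedBy (r, θ) (r', θ') (|r - r'| + |S.m r'| * |θ - θ'|) := by
  have h1 : S.JoinedBy (r, θ) (r', θ) |r - r'| := by
    have h := JoinedBy.curve (S := S) (fun t => r + t * (r' - r)) (fun _ => θ) (by fun_prop)
      (by fun_prop) (fun t ht => by
        have := (convex_Icc 0 (2 * S.a)).add_smul_sub_mem hr hr' ht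
        simpa using this)
    have hd : deriv (fun t : ℝ => r + t * (r' - r)) = fun _ => r' - r := by
      ext t
      simp
    rw [curveLength, hd] at h
    simpa [Real.sqrt_sq_eq_abs, abs_sub_comm] using h
  have h2 : S.JoinedBy (r', θ) (r', θ') (|S.m r'| * |θ - θ'|) := by
    have h := JoinedBy.curve (S := S) (fun _ => r') (fun t => θ + t * (θ' - θ)) (by fun_prop)
      (by fun_prop) (fun _ _ => hr')
    have hd : deriv (fun t : ℝ => θ + t * (θ' - θ)) = fun _ => θ' - θ := by
      ext t
      simp
    rw [curveLength, hd] at h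
    simpa [← mul_pow, Real.sqrt_sq_eq_abs, abs_sub_comm, abs_mul] using h
  exact h1.trans _ _ _ _ _ h2

theorem rdist_le {r θ θ₀ : ℝ} (hr : r ∈ Icc 0 (2 * S.a)) :
    S.rdist (r, θ) (S.a, θ₀) ≤ |r - S.a| + S.b * |θ - θ₀| := by
  have ha := S.a_pos
  have h := joinedBy_meridian_parallel (θ := θ) (θ' := θ₀) hr (r' := S.a) ⟨ha.le, by linarith⟩
  rw [show |S.m S.a| = S.b from abs_of_pos S.b_pos] at h
  exact csInf_le (bddBelow_lengths _ _) h

theorem abs_sub_le_rdist {f : ℝ × ℝ → ℝ} {C : ℝ} (hC : 0 ≤ C)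
    (hsame : ∀ P Q, S.SamePoint P Q → f P = f Q)
    (hcurve : ∀ u v : ℝ → ℝ, ContDiff ℝ 1 u → ContDiff ℝ 1 v →
      (∀ t ∈ Icc (0 : ℝ) 1, u t ∈ Icc 0 (2 * S.a)) →
      |f (u 0, v 0) - f (u 1, v 1)| ≤ C * S.curveLength u v)
    {P Q : ℝ × ℝ} (hP : P.1 ∈ Icc 0 (2 * S.a)) (hQ : Q.1 ∈ Icc 0 (2 * S.a)) :
    |f P - f Q| ≤ C * S.rdist P Q := by
  have hne : {L | S.JoinedBy P Q L}.Nonempty := ⟨_, joinedBy_meridian_parallel hP hQ⟩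
  rcases hC.eq_or_lt with rfl | hC
  · obtain ⟨L, hL⟩ := hne
    simpa using JoinedBy.abs_sub_le hsame hcurve hL
  · rw [mul_comm, ← div_le_iff₀ hC]
    refine le_csInf hne fun L hL => ?_
    rw [div_le_iff₀ hC, mul_comm]
    exact JoinedBy.abs_sub_le hsame hcurve hL

theorem abs_sub_fst_le_rdist {P Q : ℝ × ℝ} (hP : P.1 ∈ Icc 0 (2 * S.a))
    (hQ : Q.1 ∈ Icc 0 (2 * S.a)) : |P.1 - Q.1| ≤ S.rdist P Q := by
  have := abs_sub_le_rdist (S := S) (f := Prod.fst) zero_le_one (fun P Q h => h.1)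
    (fun u v hu hv _ => ?_) hP hQ
  · simpa using this
  · refine abs_sub_le_curveLength hu hv
      (fun t => (hu.differentiable one_ne_zero t).hasDerivAt) (hu.continuous_deriv le_rfl) fun t _ => ?_
    rw [one_mul]
    refine Real.abs_le_sqrt ?_
    nlinarith [mul_nonneg (sq_nonneg (S.m (u t))) (sq_nonneg (deriv v t))]

/-- For periodic `g` the function `m(r) g(θ)` descends to the sphere, as it vanishes at the poles,
where the longitude is arbitrary. Its gradient is at most `sup |m'| + 1`, independently of `g`. -/
theorem exists_abs_sub_le_rdist (S : TwoSphereOfRevolution) : ∃ C, 0 < C ∧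
    ∀ g : ℝ → ℝ, ContDiff ℝ 1 g → (∀ x, |g x| ≤ 1) → (∀ x, |deriv g x| ≤ 1) →
      (∀ (x : ℝ) (k : ℤ), g (x + 2 * Real.pi * k) = g x) →
      ∀ P Q : ℝ × ℝ, P.1 ∈ Icc 0 (2 * S.a) → Q.1 ∈ Icc 0 (2 * S.a) →
        |S.m P.1 * g P.2 - S.m Q.1 * g Q.2| ≤ C * S.rdist P Q := by
  have hdc : Continuous (deriv S.m) :=
    continuous_iff_continuousAt.2 fun r => (S.hasDerivAt_deriv_m r).continuousAt
  obtain ⟨M, hM⟩ := (isCompact_Icc (a := (0 : ℝ)) (b := 2 * S.a)).exists_bound_of_continuousOn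
    hdc.continuousOn
  have hM0 : 0 ≤ M := (norm_nonneg _).trans (hM 0 ⟨le_rfl, by linarith [S.a_pos]⟩)
  refine ⟨M + 1, by linarith, fun g hg hg1 hg2 hper P Q hP hQ => ?_⟩
  refine abs_sub_le_rdist (f := fun P => S.m P.1 * g P.2) (by linarith) ?_ ?_ hP hQ
  · rintro P Q ⟨h1, ⟨k, hk⟩ | h2 | h2⟩
    · simp only [← h1, hk, hper]
    · simp only [← h1, h2, S.m_zero, zero_mul]
    · simp only [← h1, h2, S.m_two_a, zero_mul]
  · intro u v hu hv hmem
    have hu' := fun t => (hu.differentiable one_ne_zero t).hasDerivAt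
    have hv' := fun t => (hv.differentiable one_ne_zero t).hasDerivAt
    have h1 : Continuous (deriv u) := hu.continuous_deriv le_rfl
    have h2 : Continuous (deriv v) := hv.continuous_deriv le_rfl
    have h3 : Continuous (deriv g) := hg.continuous_deriv le_rfl
    refine abs_sub_le_curveLength (g := fun t => S.m (u t) * g (v t))
      (g' := fun t => deriv S.m (u t) * deriv u t * g (v t)
        + S.m (u t) * (deriv g (v t) * deriv v t)) hu hv (fun t => ?_) ?_ fun t ht => ?_
    · exact (HasDerivAt.comp t (S.hasDerivAt_m (u t)) (hu' t)).mul
        (HasDerivAt.comp t (hg.differentiable one_ne_zero (v t)).hasDerivAt (hv' t))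
    · exact (((hdc.comp hu.continuous).mul h1).mul (hg.continuous.comp hv.continuous)).add
        ((S.smooth.continuous.comp hu.continuous).mul ((h3.comp hv.continuous).mul h2))
    · set s := √(deriv u t ^ 2 + S.m (u t) ^ 2 * deriv v t ^ 2) with hs
      have hs1 : |deriv u t| ≤ s := by
        refine Real.abs_le_sqrt ?_
        nlinarith [mul_nonneg (sq_nonneg (S.m (u t))) (sq_nonneg (deriv v t))]
      have hs2 : |S.m (u t) * deriv v t| ≤ s := by
        refine Real.abs_le_sqrt ?_
        nlinarith [sq_nonneg (deriv u t)]
      have hs0 : 0 ≤ s := Real.sqrt_nonneg _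
      have e1 : |deriv S.m (u t) * deriv u t * g (v t)| ≤ M * s := by
        rw [abs_mul, abs_mul]
        have h4 : |deriv S.m (u t)| * |deriv u t| ≤ M * s :=
          mul_le_mul (hM _ (hmem t ht)) hs1 (abs_nonneg _) hM0
        calc _ ≤ M * s * 1 := mul_le_mul h4 (hg1 _) (abs_nonneg _) (by positivity)
          _ = M * s := mul_one _
      have e2 : |S.m (u t) * (deriv g (v t) * deriv v t)| ≤ s := by
        rw [show S.m (u t) * (deriv g (v t) * deriv v t)
          = deriv g (v t) * (S.m (u t) * deriv v t) by ring, abs_mul]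
        calc _ ≤ 1 * s := mul_le_mul (hg2 _) hs2 (abs_nonneg _) zero_le_one
          _ = s := one_mul _
      calc _ ≤ M * s + s := (abs_add_le _ _).trans (add_le_add e1 e2)
        _ = (M + 1) * s := by ring

/-- Near the equator the distance to an equator point controls the difference of longitudes. -/
theorem exists_abs_sub_snd_le_rdist (S : TwoSphereOfRevolution) : ∃ K κ, 0 < K ∧ 0 < κ ∧
    ∀ (P : ℝ × ℝ) (θ₀ : ℝ), P.1 ∈ Icc 0 (2 * S.a) → S.b / 2 ≤ S.m P.1 →
      |P.2 - θ₀| ≤ 3 * Real.pi / 2 → S.rdist P (S.a, θ₀) < κ →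
      |P.2 - θ₀| ≤ K * S.rdist P (S.a, θ₀) := by
  obtain ⟨C, hC, hlip⟩ := S.exists_abs_sub_le_rdist
  have hb := S.b_pos
  have hπ := Real.pi_pos
  refine ⟨Real.pi * C / S.b, S.b / C, by positivity, by positivity, fun P θ₀ hP hm hθ hd => ?_⟩
  have hQ : ((S.a, θ₀) : ℝ × ℝ).1 ∈ Icc 0 (2 * S.a) :=
    ⟨S.a_pos.le, by linarith [S.a_pos]⟩
  -- The cosine test excludes `π/2 ≤ |θ - θ₀| ≤ 3π/2` once the distance is below `b/C`, since it
  -- makes `cos(θ - θ₀)` positive. On the remaining range the sine test gives the linear bound by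
  -- Jordan's inequality.
  have hcos := hlip (fun x => Real.cos (x - θ₀)) (by fun_prop) (fun x => Real.abs_cos_le_one _)
    (fun x => by simpa [deriv_comp_sub_const] using Real.abs_sin_le_one _)
    (fun x k => by
      rw [show x + 2 * Real.pi * k - θ₀ = x - θ₀ + k * (2 * Real.pi) by ring]
      exact Real.cos_add_int_mul_two_pi _ _) P (S.a, θ₀) hP hQ
  have hsin := hlip (fun x => Real.sin (x - θ₀)) (by fun_prop) (fun x => Real.abs_sin_le_one _)
    (fun x => by simpa [deriv_comp_sub_const] using Real.abs_cos_le_one _)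
    (fun x k => by
      rw [show x + 2 * Real.pi * k - θ₀ = x - θ₀ + k * (2 * Real.pi) by ring]
      exact Real.sin_add_int_mul_two_pi _ _) P (S.a, θ₀) hP hQ
  simp only [sub_self, Real.cos_zero, Real.sin_zero, mul_one, mul_zero, sub_zero] at hcos hsin
  have hmb : S.m S.a = S.b := rfl
  set Δ := P.2 - θ₀ with hΔ
  set d := S.rdist P (S.a, θ₀) with hd'
  have h1 : C * d < S.b := by
    rw [lt_div_iff₀ hC] at hd
    linarith
  have h2 : 0 < Real.cos Δ := by
    have h3 := (abs_le.1 hcos).1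
    rw [hmb] at h3
    have : 0 < S.m P.1 * Real.cos Δ := by linarith
    exact (mul_pos_iff_of_pos_left (by linarith)).1 this
  have h3 : |Δ| < Real.pi / 2 := by
    by_contra h4
    push Not at h4
    have := Real.cos_nonpos_of_pi_div_two_le_of_le h4 (by linarith)
    rw [Real.cos_abs] at this
    linarith
  have h4 : 2 / Real.pi * |Δ| ≤ |Real.sin Δ| := Real.mul_abs_le_abs_sin h3.le
  rw [abs_mul, abs_of_pos (by linarith : 0 < S.m P.1)] at hsin
  have h5 : S.b / 2 * (2 / Real.pi * |Δ|) ≤ C * d :=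
    (mul_le_mul hm h4 (by positivity) (by linarith)).trans hsin
  rw [div_mul_eq_mul_div, le_div_iff₀ hb]
  field_simp at h5
  linarith


/-! ### Geodesics close to the equator -/

variable {S : TwoSphereOfRevolution}

theorem nonneg_of_hasDerivAt {f f' : ℝ → ℝ} (hf : ∀ t, HasDerivAt f (f' t) t) (hf' : ∀ t, 0 ≤ f' t)
    (h0 : f 0 = 0) {t : ℝ} (ht : 0 ≤ t) : 0 ≤ f t := by
  have : Monotone f := monotone_of_deriv_nonneg (fun t => (hf t).differentiableAt)
    fun t => by rw [(hf t).deriv]; exact hf' t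
  simpa [h0] using this ht

/-- Integration of a first order expansion with respect to the angle variable. -/
theorem abs_sub_angle_expansion_le {τ s g f : ℝ → ℝ} {q Y₀ Y₁ Y₂ M : ℝ}
    (hτ : ∀ t, HasDerivAt τ (s t) t) (hs : ∀ t, 0 < s t) (hτ0 : τ 0 = 0)
    (hg : ∀ t, HasDerivAt g (f t) t) (hg0 : g 0 = 0)
    (hf : ∀ t, |f t / s t - (Y₀ + Y₁ * q + Y₂ * (q * Real.sin (τ t) ^ 2))| ≤ M * q ^ 2)
    {t : ℝ} (ht : 0 ≤ t) :
    |g t - (Y₀ * τ t + q * (Y₁ * τ t + Y₂ * (τ t / 2 - Real.sin (2 * τ t) / 4)))|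
      ≤ M * q ^ 2 * τ t := by
  -- `τ/2 - sin(2τ)/4` is the primitive of `sin² τ` with respect to `τ`.
  have hG : ∀ t, HasDerivAt
      (fun t => Y₀ * τ t + q * (Y₁ * τ t + Y₂ * (τ t / 2 - Real.sin (2 * τ t) / 4)))
      ((Y₀ + Y₁ * q + Y₂ * (q * Real.sin (τ t) ^ 2)) * s t) t := by
    intro t
    have h1 := ((hτ t).const_mul Y₀).add ((((hτ t).const_mul Y₁).add
      ((((hτ t).div_const 2).sub ((((hτ t).const_mul 2).sin).div_const 4)).const_mul Y₂)).const_mul q)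
    refine h1.congr_deriv ?_
    rw [Real.cos_two_mul, Real.cos_sq']
    ring
  have hb : ∀ t, |f t - (Y₀ + Y₁ * q + Y₂ * (q * Real.sin (τ t) ^ 2)) * s t|
      ≤ M * q ^ 2 * s t := by
    intro t
    have := mul_le_mul_of_nonneg_right (hf t) (hs t).le
    rwa [← abs_of_pos (hs t), ← abs_mul, abs_of_pos (hs t), sub_mul,
      div_mul_cancel₀ _ (hs t).ne'] at this
  rw [abs_le]
  constructor
  · have := nonneg_of_hasDerivAt
      (fun t => ((hg t).sub (hG t)).add ((hτ t).const_mul (M * q ^ 2)))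
      (fun t => by linarith [(abs_le.1 (hb t)).1]) (by simp [hτ0, hg0]) ht
    simp only [Pi.add_apply, Pi.sub_apply] at this
    linarith
  · have := nonneg_of_hasDerivAt
      (fun t => ((hτ t).const_mul (M * q ^ 2)).sub ((hg t).sub (hG t)))
      (fun t => by linarith [(abs_le.1 (hb t)).2]) (by simp [hτ0, hg0]) ht
    simp only [Pi.sub_apply] at this
    linarith

/-- The description of the geodesic `c_η` for small `η` as an oscillation about the equator with
angle variable `τ`, with its expansion in powers of `q = b - b cos η`. -/
structure Oscillation (S : TwoSphereOfRevolution) (A₁ A₂ B₁ B₂ M η : ℝ) (c : ℝ → ℝ × ℝ)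
    (τ : ℝ → ℝ) : Prop where
  zero : τ 0 = 0
  cont : Continuous τ
  strictMono : StrictMono τ
  deriv_r : ∀ t, ∃ k, 0 < k ∧
    -deriv (fun t => (c t).1) t = k * (√(2 * S.b) * Real.sin (η / 2) * Real.cos (τ t))
  abs_r_sub_le : ∀ t,
    |S.a - (c t).1 - √(2 * S.b) * Real.sin (η / 2) * Real.sin (τ t) / √S.α|
      ≤ M * (S.b - S.b * Real.cos η) * |√(2 * S.b) * Real.sin (η / 2) * Real.sin (τ t)|
  abs_time_sub_le : ∀ t, 0 ≤ t →
    |t - (S.b / √(2 * S.α * S.b) * τ t + (S.b - S.b * Real.cos η) *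
      (A₁ * τ t + A₂ * (τ t / 2 - Real.sin (2 * τ t) / 4)))|
      ≤ M * (S.b - S.b * Real.cos η) ^ 2 * τ t
  abs_θ_sub_le : ∀ t, 0 ≤ t →
    |(c t).2 - (1 / √(2 * S.α * S.b) * τ t + (S.b - S.b * Real.cos η) *
      (B₁ * τ t + B₂ * (τ t / 2 - Real.sin (2 * τ t) / 4)))|
      ≤ M * (S.b - S.b * Real.cos η) ^ 2 * τ t

theorem tendsto_clairaut_defect (S : TwoSphereOfRevolution) :
    Tendsto (fun η : ℝ => S.b - S.b * Real.cos η) (𝓝 0) (𝓝 0) := by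
  have : Continuous fun η : ℝ => S.b - S.b * Real.cos η := by fun_prop
  simpa using this.tendsto 0

theorem eventually_mem_Ioo_pi :
    ∀ᶠ η in 𝓝 (0 : ℝ), η ∈ Ioo (-(Real.pi / 2)) (Real.pi / 2) :=
  Ioo_mem_nhds (by linarith [Real.pi_pos]) (by linarith [Real.pi_pos])

theorem eventually_abs_lt {χ D : ℝ → ℝ} {ε : ℝ} (hα : 0 < S.α) (hch : S.EquatorialChart χ D ε)
    {c : ℝ → ℝ → ℝ × ℝ}
    (hc : ∀ η ∈ Ioo (-(Real.pi / 2)) (Real.pi / 2), S.IsEquatorGeodesic η (c η))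
    {δ : ℝ} (hδ : 0 < δ) : ∀ᶠ η in 𝓝 (0 : ℝ), ∀ t, |S.a - (c η t).1| < δ := by
  set δ' := min δ (ε / 2) with hδ'
  have h1 : 0 < δ' := lt_min hδ (half_pos hch.eps_pos)
  have h2 : δ' < ε := (min_le_right _ _).trans_lt (half_lt_self hch.eps_pos)
  filter_upwards [eventually_mem_Ioo_pi, S.tendsto_clairaut_defect.eventually_lt_const
    (by positivity : 0 < S.α / 2 * δ' ^ 2)] with η hη hη' t
  exact ((hc η hη).abs_lt_of_chart hch h1 h2 hη' t).trans_le (min_le_left _ _)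

/-- First order expansions along the geodesics close to the equator, uniformly in time. -/
theorem firstOrder_chart {χ D : ℝ → ℝ} {ε : ℝ} (hα : 0 < S.α) (hch : S.EquatorialChart χ D ε)
    {c : ℝ → ℝ → ℝ × ℝ}
    (hc : ∀ η ∈ Ioo (-(Real.pi / 2)) (Real.pi / 2), S.IsEquatorGeodesic η (c η)) :
    (fun i : ℝ × ℝ => S.b - S.m (c i.1 i.2).1) =O[𝓝 0 ×ˢ ⊤]
      (fun i => S.b - S.b * Real.cos i.1) ∧
    FirstOrder (𝓝 0 ×ˢ ⊤) (fun i : ℝ × ℝ => S.b - S.b * Real.cos i.1)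
      (fun i => S.b - S.m (c i.1 i.2).1) (fun i => χ ((S.a - (c i.1 i.2).1) ^ 2))
      S.α 0 (-S.β / S.α) ∧
    FirstOrder (𝓝 0 ×ˢ ⊤) (fun i : ℝ × ℝ => S.b - S.b * Real.cos i.1)
      (fun i => S.b - S.m (c i.1 i.2).1) (fun i => D ((S.a - (c i.1 i.2).1) ^ 2))
      S.α 0 (-2 * S.β / S.α) := by
  -- The factor `⊤` in the time variable makes every estimate along `l` uniform in time.
  set l : Filter (ℝ × ℝ) := 𝓝 0 ×ˢ ⊤ with hl
  set q : ℝ × ℝ → ℝ := fun i => S.b - S.b * Real.cos i.1 with hq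
  set p : ℝ × ℝ → ℝ := fun i => S.b - S.m (c i.1 i.2).1 with hp
  set z : ℝ × ℝ → ℝ := fun i => (S.a - (c i.1 i.2).1) ^ 2 with hz
  have hx : ∀ δ > 0, ∀ᶠ i : ℝ × ℝ in l, |S.a - (c i.1 i.2).1| < δ := by
    intro δ hδ
    filter_upwards [tendsto_fst.eventually (eventually_abs_lt hα hch hc hδ)] with i hi
    exact hi i.2
  have hx0 : Tendsto (fun i : ℝ × ℝ => S.a - (c i.1 i.2).1) l (𝓝 0) := by
    rw [Metric.tendsto_nhds]
    intro δ hδ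
    simpa using hx δ hδ
  have hz0 : Tendsto z l (𝓝 0) := tendsto_sq_zero.comp hx0
  have hpz : ∀ᶠ i in l, p i = z i * χ (z i) := by
    filter_upwards [hx ε hch.eps_pos] with i hi
    have := hch.m_eq _ hi
    rw [sub_sub_cancel] at this
    simp only [hp, this]
    ring
  have hpq : ∀ᶠ i in l, p i ≤ q i := by
    filter_upwards [tendsto_fst.eventually eventually_mem_Ioo_pi] with i hi
    have := (hc i.1 hi).clairaut_le_m i.2
    simp only [hp, hq]
    linarith
  have hzp : ∀ᶠ i in l, S.α / 2 * z i ≤ p i := by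
    filter_upwards [hpz, hx ε hch.eps_pos] with i hi hi'
    have h1 := hch.χ_pos _ hi'
    have h2 : 0 ≤ z i := sq_nonneg _
    rw [hi]
    nlinarith
  have hzq : z =O[l] q := by
    refine IsBigO.of_bound (2 / S.α) ?_
    filter_upwards [hzp, hpq] with i h1 h2
    have h3 : 0 ≤ z i := sq_nonneg _
    have h5 : S.α / 2 * z i ≤ q i := h1.trans h2
    have h4 : 0 ≤ q i := le_trans (by positivity) h5
    rw [Real.norm_of_nonneg h3, Real.norm_of_nonneg h4, div_mul_eq_mul_div, le_div_iff₀ hα]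
    linarith
  have hpO : p =O[l] q := by
    refine IsBigO.of_bound 1 ?_
    filter_upwards [hzp, hpq] with i h1 h2
    have h3 : 0 ≤ z i := sq_nonneg _
    have h5 : 0 ≤ p i := le_trans (by positivity) h1
    rw [Real.norm_of_nonneg h5, Real.norm_of_nonneg (h5.trans h2)]
    linarith
  have hzq2 : (fun i => z i ^ 2) =O[l] fun i => q i ^ 2 := hzq.pow 2
  have hχz : (fun i => χ (z i) - (S.α - S.β * z i)) =O[l] fun i => q i ^ 2 :=
    (hch.χ_taylor.comp_tendsto hz0).trans hzq2
  have hDz : (fun i => D (z i) - (S.α - 2 * S.β * z i)) =O[l] fun i => q i ^ 2 :=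
    (hch.D_taylor.comp_tendsto hz0).trans hzq2
  -- Inversion of `p = z χ(z) = α z + O(z²)`, where `z = (a - r)² = O(q)`.
  have hzF : FirstOrder l q p z 0 0 (1 / S.α) := by
    have h1 : (fun i => z i * (χ (z i) - (S.α - S.β * z i))) =O[l] fun i => q i ^ 2 := by
      have := (hz0.isBigO_one ℝ).mul hχz
      simpa using this
    have h2 := (h1.sub (hzq2.const_mul_left S.β)).const_mul_left (-1 / S.α)
    refine h2.congr' ?_ EventuallyEq.rfl
    filter_upwards [hpz] with i hi
    rw [hi]
    field_simp
    ring
  refine ⟨hpO, ?_, ?_⟩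
  · have h1 := (FirstOrder.const (l := l) (q := q) (p := p) S.α).sub
      ((FirstOrder.const S.β).mul hzF ?_ hpO)
    · refine (hχz.add h1).congr_left fun i => ?_
      simp only [hz]
      ring
    · exact S.tendsto_clairaut_defect.comp tendsto_fst
  · have h1 := (FirstOrder.const (l := l) (q := q) (p := p) S.α).sub
      ((FirstOrder.const (2 * S.β)).mul hzF ?_ hpO)
    · refine (hDz.add h1).congr_left fun i => ?_
      simp only [hz]
      ring
    · exact S.tendsto_clairaut_defect.comp tendsto_fst


/-! ### Time and longitude as functions of the angle -/

variable {S : TwoSphereOfRevolution}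

theorem sqrt_two_α_b (hα : 0 < S.α) : √(2 * S.α * S.b) = √S.α * √(S.b + S.b) := by
  rw [← Real.sqrt_mul hα.le]
  congr 1
  ring

theorem one_div_angleSpeed (χ D : ℝ → ℝ) (ν r : ℝ) : 1 / S.angleSpeed χ D ν r =
    √(χ ((S.a - r) ^ 2)) / D ((S.a - r) ^ 2) * (S.m r / √(S.m r + ν)) := by
  rw [angleSpeed, one_div, mul_inv, inv_div, inv_div]

/-- The two functions are `dt/dτ` and `dθ/dτ`. Of the longitude coefficients only `B₁ + B₂/2`
matters later, the mean of `B₁ + B₂ sin² τ` over half a turn; it produces the constant `C`. -/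
theorem firstOrder_time {χ D : ℝ → ℝ} {ε : ℝ} (hα : 0 < S.α) (hch : S.EquatorialChart χ D ε)
    {c : ℝ → ℝ → ℝ × ℝ}
    (hc : ∀ η ∈ Ioo (-(Real.pi / 2)) (Real.pi / 2), S.IsEquatorGeodesic η (c η)) :
    ∃ A₁ A₂ B₁ B₂, S.b * (S.b / 2) * Real.pi * (B₁ + B₂ / 2) = S.cubicConst ∧
    FirstOrder (𝓝 0 ×ˢ ⊤) (fun i : ℝ × ℝ => S.b - S.b * Real.cos i.1)
      (fun i => S.b - S.m (c i.1 i.2).1)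
      (fun i => 1 / S.angleSpeed χ D (S.b * Real.cos i.1) (c i.1 i.2).1)
      (S.b / √(2 * S.α * S.b)) A₁ A₂ ∧
    FirstOrder (𝓝 0 ×ˢ ⊤) (fun i : ℝ × ℝ => S.b - S.b * Real.cos i.1)
      (fun i => S.b - S.m (c i.1 i.2).1)
      (fun i => S.b * Real.cos i.1 / S.m (c i.1 i.2).1 ^ 2
        / S.angleSpeed χ D (S.b * Real.cos i.1) (c i.1 i.2).1)
      (1 / √(2 * S.α * S.b)) B₁ B₂ := by
  obtain ⟨hp, hχ, hD⟩ := firstOrder_chart hα hch hc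
  have hb := S.b_pos
  have hq : Tendsto (fun i : ℝ × ℝ => S.b - S.b * Real.cos i.1) (𝓝 0 ×ˢ ⊤) (𝓝 0) :=
    S.tendsto_clairaut_defect.comp tendsto_fst
  set l : Filter (ℝ × ℝ) := 𝓝 0 ×ˢ ⊤ with hl
  set q : ℝ × ℝ → ℝ := fun i => S.b - S.b * Real.cos i.1 with hqd
  set p : ℝ × ℝ → ℝ := fun i => S.b - S.m (c i.1 i.2).1 with hpd
  have hm : FirstOrder l q p (fun i => S.m (c i.1 i.2).1) S.b 0 (-1) :=
    (((FirstOrder.const S.b).sub FirstOrder.snd).congr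
      (Eventually.of_forall fun i => by simp [hpd])).of_eq (by simp) (by simp) (by simp)
  have hν : FirstOrder l q p (fun i => S.b * Real.cos i.1) S.b (-1) 0 :=
    (((FirstOrder.const S.b).sub FirstOrder.fst).congr
      (Eventually.of_forall fun i => by simp [hqd])).of_eq (by simp) (by simp) (by simp)
  have hs : 0 < √(S.b + S.b) := Real.sqrt_pos.2 (by linarith)
  have hsα : 0 < √S.α := Real.sqrt_pos.2 hα
  have hA := ((hχ.sqrt hq hp hα).div hD hq hp hα.ne').mul
    (hm.div ((hm.add hν).sqrt hq hp (by linarith)) hq hp hs.ne') hq hp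
  have hB := (hν.div (hm.mul hm hq hp) hq hp (by positivity)).mul hA hq hp
  -- The coefficients are read off from the expansions by unification. In closed form `B₁ =
  -- -3/(4b√(2αb))` and `B₂ = (5/(4b) + 3β/(2α²))/√(2αb)`, so `B₁ + B₂/2 = (6bβ - α²)/(8bα²√(2αb))`.
  refine ⟨_, _, _, _, ?_, (hA.congr ?_).of_eq ?_ rfl rfl, (hB.congr ?_).of_eq ?_ rfl rfl⟩
  · have h1 : S.α ^ (5 / 2 : ℝ) = S.α ^ 2 * √S.α := by
      rw [Real.sqrt_eq_rpow, ← Real.rpow_natCast, ← Real.rpow_add hα]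
      norm_num
    have h2 : √(S.b + S.b) = √2 * √S.b := by
      rw [← Real.sqrt_mul (by norm_num)]
      congr 1
      ring
    have e1 := Real.sq_sqrt hα.le
    have e2 := Real.sq_sqrt hb.le
    have e3 := Real.sq_sqrt (zero_le_two (α := ℝ))
    rw [cubicConst, h1, h2]
    have hsb : 0 < √S.b := Real.sqrt_pos.2 hb
    have hs2 : 0 < √(2 : ℝ) := Real.sqrt_pos.2 two_pos
    generalize √S.b = y at *
    generalize √S.α = x at *
    generalize √(2 : ℝ) = w at *
    rw [← e1, ← e2]
    field_simp
    rw [e3]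
    ring
  · filter_upwards with i
    rw [one_div_angleSpeed]
  · rw [sqrt_two_α_b hα]
    have := Real.sq_sqrt hα.le
    field_simp
    linarith
  · filter_upwards with i
    rw [div_eq_mul_one_div _ (S.angleSpeed _ _ _ _), one_div_angleSpeed, sq (S.m _)]
  · rw [sqrt_two_α_b hα]
    have := Real.sq_sqrt hα.le
    field_simp
    linarith

theorem exists_oscillation (hA1 : S.LocallyReflectionSymmetric) (hα : 0 < S.α)
    {c : ℝ → ℝ → ℝ × ℝ}
    (hc : ∀ η ∈ Ioo (-(Real.pi / 2)) (Real.pi / 2), S.IsEquatorGeodesic η (c η)) :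
    ∃ A₁ A₂ B₁ B₂ M, 0 ≤ M ∧ S.b * (S.b / 2) * Real.pi * (B₁ + B₂ / 2) = S.cubicConst ∧
      ∀ᶠ η in 𝓝 (0 : ℝ), ∃ τ, S.Oscillation A₁ A₂ B₁ B₂ M η (c η) τ := by
  obtain ⟨χ, D, ε, hch⟩ := hA1.exists_chart hα
  have hb := S.b_pos
  obtain ⟨A₁, A₂, B₁, B₂, hrel, hA, hB⟩ := firstOrder_time hα hch hc
  obtain ⟨hp, hχ, -⟩ := firstOrder_chart hα hch hc
  have hq : Tendsto (fun i : ℝ × ℝ => S.b - S.b * Real.cos i.1) (𝓝 0 ×ˢ ⊤) (𝓝 0) :=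
    S.tendsto_clairaut_defect.comp tendsto_fst
  have hsα : 0 < √S.α := Real.sqrt_pos.2 hα
  obtain ⟨C₁, h₁⟩ := IsBigO.bound hA
  obtain ⟨C₂, h₂⟩ := IsBigO.bound hB
  obtain ⟨C₃, h₃⟩ := (((hχ.sqrt hq hp hα).inv hq hp hsα.ne').sub_const_isBigO hq hp).bound
  set M := max (max C₁ C₂) (max C₃ 0) with hM
  have hM1 : C₁ ≤ M := (le_max_left _ _).trans (le_max_left _ _)
  have hM2 : C₂ ≤ M := (le_max_right _ _).trans (le_max_left _ _)
  have hM3 : C₃ ≤ M := (le_max_left _ _).trans (le_max_right _ _)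
  have hM0 : 0 ≤ M := (le_max_right _ _).trans (le_max_right _ _)
  refine ⟨A₁, A₂, B₁, B₂, M, hM0, hrel, ?_⟩
  -- Currying turns the uniform estimates into statements for all small `η` and, for each of them,
  -- all times.
  filter_upwards [h₁.curry, h₂.curry, h₃.curry, eventually_mem_Ioo_pi,
    eventually_abs_lt hα hch hc hch.eps_pos] with η g₁ g₂ g₃ hη hx
  rw [eventually_top] at g₁ g₂ g₃
  have h := hc η hη
  obtain ⟨τ, hτ0, hτ, hsin, hcos⟩ := h.exists_angle hα hch hη hx
  set ρ := √(2 * S.b) * Real.sin (η / 2) with hρ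
  have hν := IsEquatorGeodesic.clairaut_pos (S := S) hη
  have hχpos : ∀ t, 0 < χ ((S.a - (c η t).1) ^ 2) := fun t => by linarith [hch.χ_pos _ (hx t)]
  have hspeed : ∀ t, 0 < S.angleSpeed χ D (S.b * Real.cos η) (c η t).1 := by
    intro t
    have h1 := hch.D_pos _ (hx t)
    have h2 := hχpos t
    have h3 := h.m_pos t
    rw [angleSpeed]
    positivity
  have hq0 : 0 ≤ S.b - S.b * Real.cos η := by nlinarith [Real.cos_le_one η]
  have hqρ : S.b - S.b * Real.cos η = ρ ^ 2 := by
    have h1 : Real.cos η = 1 - 2 * Real.sin (η / 2) ^ 2 := by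
      have h2 := Real.cos_two_mul (η / 2)
      rw [mul_div_cancel₀ _ two_ne_zero, Real.cos_sq'] at h2
      rw [h2]
      ring
    rw [hρ, mul_pow, Real.sq_sqrt (by positivity), h1]
    ring
  -- This is `u² = ρ² sin² τ`. The relation is exact, so the expansions in `p` become expansions in
  -- `q sin² τ`, ready for integration.
  have hpt : ∀ t, S.b - S.m (c η t).1 = (S.b - S.b * Real.cos η) * Real.sin (τ t) ^ 2 := by
    intro t
    have h1 := hch.m_eq _ (hx t)
    rw [sub_sub_cancel] at h1
    rw [h1, hqρ, ← mul_pow, ← hsin t, mul_pow, Real.sq_sqrt (hχpos t).le]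
    ring
  refine ⟨τ, hτ0, continuous_iff_continuousAt.2 fun t => (hτ t).continuousAt,
    strictMono_of_deriv_pos fun t => by rw [(hτ t).deriv]; exact hspeed t,
    fun t => ?_, fun t => ?_, fun t ht => ?_, fun t ht => ?_⟩
  · have h1 := h.m_pos t
    have h2 : 0 < √(S.m (c η t).1 + S.b * Real.cos η) := Real.sqrt_pos.2 (by linarith)
    refine ⟨√(S.m (c η t).1 + S.b * Real.cos η) / S.m (c η t).1, by positivity, ?_⟩
    rw [← hcos t]
    field_simp
  · have h1 := g₃ t
    have h2 : 0 < √(χ ((S.a - (c η t).1) ^ 2)) := Real.sqrt_pos.2 (hχpos t)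
    rw [Real.norm_eq_abs, Real.norm_of_nonneg hq0] at h1
    -- The height is `u/√χ`, and `1/√χ` differs from `1/√α` by `O(q)`.
    have h3 : S.a - (c η t).1 - ρ * Real.sin (τ t) / √S.α
        = ((√(χ ((S.a - (c η t).1) ^ 2)))⁻¹ - (√S.α)⁻¹) * (ρ * Real.sin (τ t)) := by
      rw [← hsin t]
      field_simp
    rw [h3, abs_mul]
    refine mul_le_mul_of_nonneg_right (h1.trans ?_) (abs_nonneg _)
    exact mul_le_mul_of_nonneg_right hM3 hq0
  · refine abs_sub_angle_expansion_le hτ hspeed hτ0 (g := fun t => t) (f := fun _ => 1)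
      hasDerivAt_id' rfl (fun t => ?_) ht
    have h1 := g₁ t
    simp only [Real.norm_eq_abs] at h1
    rw [abs_of_nonneg (sq_nonneg (S.b - _)), hpt t] at h1
    exact h1.trans (mul_le_mul_of_nonneg_right hM1 (sq_nonneg _))
  · refine abs_sub_angle_expansion_le hτ hspeed hτ0 (g := fun t => (c η t).2)
      (f := fun t => S.b * Real.cos η / S.m (c η t).1 ^ 2)
      (fun t => by rw [← h.deriv_θ t]; exact h.hasDerivAt_θ t) (by simp [h.start]) (fun t => ?_) ht
    have h1 := g₂ t
    simp only [Real.norm_eq_abs] at h1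
    rw [abs_of_nonneg (sq_nonneg (S.b - _)), hpt t] at h1
    exact h1.trans (mul_le_mul_of_nonneg_right hM2 (sq_nonneg _))


variable {S : TwoSphereOfRevolution}

/-! ### The first return to the equator -/

/-- Until the angle reaches `π/2`, `r` decreases from `a` to the turning value `R(ν)`. Substituting
`r = r(t)` and using `m |r'| = √(m² - ν²)` turns half of `φ` into the integral of `θ' = ν/m²`. -/
theorem Oscillation.φ_eq {A₁ A₂ B₁ B₂ M η T : ℝ} {c : ℝ → ℝ × ℝ} {τ : ℝ → ℝ}
    (hm : StrictMonoOn S.m (Icc 0 S.a)) (h : S.IsEquatorGeodesic η c)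
    (ho : S.Oscillation A₁ A₂ B₁ B₂ M η c τ) (hη : η ∈ Ioo 0 (Real.pi / 2))
    (hT : τ T = Real.pi / 2) : S.φ (S.b * Real.cos η) = 2 * (c T).2 := by
  have hπ := Real.pi_pos
  have hb := S.b_pos
  have hη' : η ∈ Ioo (-(Real.pi / 2)) (Real.pi / 2) := ⟨by linarith [hη.1], hη.2⟩
  have hν := IsEquatorGeodesic.clairaut_pos (S := S) hη'
  set ν := S.b * Real.cos η with hνd
  have hρ : 0 < √(2 * S.b) * Real.sin (η / 2) :=
    mul_pos (Real.sqrt_pos.2 (by linarith))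
      (Real.sin_pos_of_pos_of_lt_pi (by linarith [hη.1]) (by linarith [hη.2]))
  have hT0 : 0 < T := by
    rw [← ho.strictMono.lt_iff_lt, ho.zero, hT]
    linarith
  have h0 : (c 0).1 = S.a := by rw [h.start]
  have hτI : ∀ t ∈ Ioo 0 T, τ t ∈ Ioo 0 (Real.pi / 2) := fun t ht => by
    rw [← ho.zero, ← hT]
    exact ⟨ho.strictMono ht.1, ho.strictMono ht.2⟩
  have hneg : ∀ t ∈ Ioo 0 T, deriv (fun t => (c t).1) t < 0 := by
    intro t ht
    obtain ⟨k, hk, hk'⟩ := ho.deriv_r t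
    have h1 := Real.cos_pos_of_mem_Ioo ⟨by linarith [(hτI t ht).1], (hτI t ht).2⟩
    have : 0 < k * (√(2 * S.b) * Real.sin (η / 2) * Real.cos (τ t)) := by positivity
    linarith
  have hanti : StrictAntiOn (fun t => (c t).1) (Icc 0 T) := by
    refine strictAntiOn_of_deriv_neg (convex_Icc 0 T)
      h.geodesic.smooth_r.continuous.continuousOn fun t ht => ?_
    rw [interior_Icc] at ht
    exact hneg t ht
  have hmT : S.m (c T).1 = ν := by
    obtain ⟨k, hk, hk'⟩ := ho.deriv_r T
    rw [hT, Real.cos_pi_div_two, mul_zero, mul_zero, neg_eq_zero] at hk'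
    have h1 := h.energy T
    rw [hk'] at h1
    have h2 := h.m_pos T
    exact (sq_eq_sq₀ h2.le hν.le).1 (by linarith)
  have hTa : (c T).1 < S.a := by
    have := hanti (left_mem_Icc.2 hT0.le) (right_mem_Icc.2 hT0.le) hT0
    simpa only [h0] using this
  have hR : S.R ν = (c T).1 := by
    have h1 : {r | r ∈ Ioc 0 S.a ∧ S.m r = ν} = {(c T).1} := by
      ext r
      simp only [mem_ofPred_eq, mem_singleton_iff]
      constructor
      · rintro ⟨hr, hr'⟩
        exact hm.injOn (Ioc_subset_Icc_self hr) ⟨(h.geodesic.mem T).1.le, hTa.le⟩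
          (hr'.trans hmT.symm)
      · rintro rfl
        exact ⟨⟨(h.geodesic.mem T).1, hTa.le⟩, hmT⟩
    rw [R, h1, csInf_singleton]
  have himage : (fun t => (c t).1) '' Ioo 0 T = Ioo (c T).1 S.a := by
    refine Subset.antisymm ?_ ?_
    · rintro _ ⟨t, ht, rfl⟩
      refine ⟨hanti (Ioo_subset_Icc_self ht) (right_mem_Icc.2 hT0.le) ht.2, ?_⟩
      have := hanti (left_mem_Icc.2 hT0.le) (Ioo_subset_Icc_self ht) ht.1
      simpa only [h0] using this
    · have := intermediate_value_Ioo' hT0.le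
        (h.geodesic.smooth_r.continuous.continuousOn (s := Icc 0 T))
      simpa only [h0] using this
  have hθ : ∀ t, HasDerivAt (fun t => (c t).2) (ν / S.m (c t).1 ^ 2) t := fun t => by
    rw [← h.deriv_θ t]
    exact h.hasDerivAt_θ t
  have hθc : Continuous fun t => ν / S.m (c t).1 ^ 2 :=
    continuous_const.div ((S.smooth.continuous.comp h.geodesic.smooth_r.continuous).pow 2)
      fun t => pow_ne_zero 2 (h.m_pos t).ne'
  have hint : ∫ t in (0 : ℝ)..T, ν / S.m (c t).1 ^ 2 = (c T).2 := by
    rw [intervalIntegral.integral_eq_sub_of_hasDerivAt (fun t _ => hθ t)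
      (hθc.intervalIntegrable _ _), h.start]
    simp
  -- The substitution is made on open intervals because the integrand is singular at `R`, where `r'`
  -- vanishes. The formula for injective maps needs no integrability in advance.
  rw [φ, hR, ← hint, intervalIntegral.integral_of_le hTa.le, intervalIntegral.integral_of_le hT0.le,
    MeasureTheory.integral_Ioc_eq_integral_Ioo, MeasureTheory.integral_Ioc_eq_integral_Ioo,
    ← himage, MeasureTheory.integral_image_eq_integral_abs_deriv_smul measurableSet_Ioo
      (fun t _ => (h.hasDerivAt_r t).hasDerivWithinAt) (hanti.injOn.mono Ioo_subset_Icc_self)]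
  congr 1
  refine MeasureTheory.setIntegral_congr_fun measurableSet_Ioo fun t ht => ?_
  have h1 := h.m_pos t
  have h2 := hneg t ht
  have h3 : √(S.m (c t).1 ^ 2 - ν ^ 2) = S.m (c t).1 * |deriv (fun t => (c t).1) t| := by
    rw [← h.energy t, ← mul_pow, Real.sqrt_sq_eq_abs, abs_mul, abs_of_pos h1]
  have h4 : 0 < |deriv (fun t => (c t).1) t| := abs_pos.2 h2.ne
  simp only [smul_eq_mul, h3]
  field_simp


variable {S : TwoSphereOfRevolution}

/-! ### Asymptotics of the geodesics close to the equator -/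

theorem clairaut_defect_isBigO (S : TwoSphereOfRevolution) :
    (fun η : ℝ => S.b - S.b * Real.cos η - S.b / 2 * η ^ 2) =O[𝓝 0] fun η => η ^ 4 := by
  refine IsBigO.of_bound (S.b * (5 / 96)) ?_
  filter_upwards [Metric.ball_mem_nhds (0 : ℝ) one_pos] with η hη
  have h1 := Real.cos_bound (by simpa using (mem_ball_zero_iff.1 hη).le : |η| ≤ 1)
  have h2 : S.b - S.b * Real.cos η - S.b / 2 * η ^ 2
      = -(S.b * (Real.cos η - (1 - η ^ 2 / 2))) := by ring
  rw [h2, norm_neg, norm_mul, Real.norm_of_nonneg S.b_pos.le, norm_pow, Real.norm_eq_abs,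
    Real.norm_eq_abs, mul_assoc]
  exact mul_le_mul_of_nonneg_left (by linarith) S.b_pos.le

theorem clairaut_defect_isBigO_sq (S : TwoSphereOfRevolution) :
    (fun η : ℝ => S.b - S.b * Real.cos η) =O[𝓝 0] fun η => η ^ 2 := by
  have h1 : (fun η : ℝ => η ^ 4) =O[𝓝 0] fun η => η ^ 2 :=
    IsBigO.of_bound 1 (by
      filter_upwards [Metric.ball_mem_nhds (0 : ℝ) one_pos] with η hη
      rw [one_mul, norm_pow, norm_pow]
      exact pow_le_pow_of_le_one (norm_nonneg _) (mem_ball_zero_iff.1 hη).le (by norm_num))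
  have := (S.clairaut_defect_isBigO.trans h1).add
    ((isBigO_refl (fun η : ℝ => η ^ 2) (𝓝 0)).const_mul_left (S.b / 2))
  refine this.congr_left fun η => ?_
  ring

theorem amplitude_isBigO (S : TwoSphereOfRevolution) :
    (fun η : ℝ => √(2 * S.b) * Real.sin (η / 2) - √(S.b / 2) * η) =O[𝓝 0] fun η => η ^ 3 := by
  refine IsBigO.of_bound (√(2 * S.b)) ?_
  filter_upwards [Metric.ball_mem_nhds (0 : ℝ) one_pos] with η hη
  have hη' : |η| ≤ 1 := by simpa using (mem_ball_zero_iff.1 hη).le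
  have h0 : |η / 2| ≤ 1 := by rw [abs_div, abs_two]; linarith
  have h1 := Real.sin_bound h0
  have hs : √(2 * S.b) = 2 * √(S.b / 2) := by
    rw [show 2 * S.b = 2 ^ 2 * (S.b / 2) by ring, Real.sqrt_mul (by positivity),
      Real.sqrt_sq zero_le_two]
  have h2 : √(2 * S.b) * Real.sin (η / 2) - √(S.b / 2) * η
      = √(2 * S.b) * ((Real.sin (η / 2) - (η / 2 - (η / 2) ^ 3 / 6)) - η ^ 3 / 48) := by
    rw [hs]; ring
  rw [h2, norm_mul, Real.norm_of_nonneg (Real.sqrt_nonneg _)]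
  refine mul_le_mul_of_nonneg_left ?_ (Real.sqrt_nonneg _)
  have h3 : |η / 2| ^ 5 ≤ |η| ^ 3 := by
    have h4 : |η| ^ 5 ≤ |η| ^ 3 := pow_le_pow_of_le_one (abs_nonneg _) hη' (by norm_num)
    have : 0 ≤ |η| ^ 3 := by positivity
    rw [abs_div, abs_two, div_pow, div_le_iff₀ (by norm_num)]
    linarith
  calc _ ≤ |Real.sin (η / 2) - (η / 2 - (η / 2) ^ 3 / 6)| + |η ^ 3 / 48| := abs_sub _ _
    _ ≤ |η| ^ 3 / 100 + |η| ^ 3 / 48 := by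
      refine add_le_add (by linarith) ?_
      rw [abs_div, abs_pow]
      norm_num
    _ ≤ ‖η ^ 3‖ := by
      rw [norm_pow, Real.norm_eq_abs]
      have : 0 ≤ |η| ^ 3 := by positivity
      linarith

/-- The longitude of the cut-conjugate point. -/
noncomputable def cutLongitude (S : TwoSphereOfRevolution) : ℝ := Real.pi / √(2 * S.α * S.b)

/-- The geodesics `c η` are oscillations about the equator for all small `η`. -/
structure OscillationFamily (S : TwoSphereOfRevolution) (A₁ A₂ B₁ B₂ M : ℝ) (c : ℝ → ℝ → ℝ × ℝ)
    (τ : ℝ → ℝ → ℝ) : Prop where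
  α_pos : 0 < S.α
  M_nonneg : 0 ≤ M
  cubic : S.b * (S.b / 2) * Real.pi * (B₁ + B₂ / 2) = S.cubicConst
  eventually : ∀ᶠ η in 𝓝 (0 : ℝ), S.Oscillation A₁ A₂ B₁ B₂ M η (c η) (τ η)

namespace OscillationFamily

variable {A₁ A₂ B₁ B₂ M : ℝ} {c : ℝ → ℝ → ℝ × ℝ} {τ : ℝ → ℝ → ℝ}

theorem sqrt_pos (h : S.OscillationFamily A₁ A₂ B₁ B₂ M c τ) : 0 < √(2 * S.α * S.b) :=
  Real.sqrt_pos.2 (by have := h.α_pos; have := S.b_pos; positivity)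

theorem tau_nonneg {η : ℝ} (ho : S.Oscillation A₁ A₂ B₁ B₂ M η (c η) (τ η)) {t : ℝ} (ht : 0 ≤ t) :
    0 ≤ τ η t := by
  rw [← ho.zero]
  exact ho.strictMono.monotone ht

theorem abs_sub_le_of_expansion {f Y₀ Y₁ Y₂ M q x : ℝ} (hx : 0 ≤ x) (hq : 0 ≤ q) (hq1 : q ≤ 1)
    (hM : 0 ≤ M)
    (h : |f - (Y₀ * x + q * (Y₁ * x + Y₂ * (x / 2 - Real.sin (2 * x) / 4)))| ≤ M * q ^ 2 * x) :
    |f - Y₀ * x| ≤ (|Y₁| + |Y₂| + M) * q * x := by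
  have h1 : |Real.sin (2 * x)| ≤ 2 * x := by
    have := Real.abs_sin_le_abs (x := 2 * x)
    rwa [abs_of_nonneg (by positivity : 0 ≤ 2 * x)] at this
  have h2 : |x / 2 - Real.sin (2 * x) / 4| ≤ x := by
    rw [abs_le] at h1 ⊢
    constructor <;> linarith
  have h3 : |q * (Y₁ * x + Y₂ * (x / 2 - Real.sin (2 * x) / 4))| ≤ q * (|Y₁| * x + |Y₂| * x) := by
    rw [abs_mul, abs_of_nonneg hq]
    refine mul_le_mul_of_nonneg_left ((abs_add_le _ _).trans (add_le_add ?_ ?_)) hq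
    · rw [abs_mul, abs_of_nonneg hx]
    · rw [abs_mul]
      exact mul_le_mul_of_nonneg_left h2 (abs_nonneg _)
  have h4 : M * q ^ 2 * x ≤ M * q * x := by
    have : 0 ≤ M * q * x * (1 - q) := mul_nonneg (by positivity) (by linarith)
    nlinarith
  have h5 : f - Y₀ * x = (f - (Y₀ * x + q * (Y₁ * x + Y₂ * (x / 2 - Real.sin (2 * x) / 4))))
      + q * (Y₁ * x + Y₂ * (x / 2 - Real.sin (2 * x) / 4)) := by ring
  rw [h5]
  refine (abs_add_le _ _).trans ((add_le_add (h.trans h4) h3).trans (le_of_eq ?_))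
  ring

/-- Zeroth order estimates. -/
theorem exists_coarse (h : S.OscillationFamily A₁ A₂ B₁ B₂ M c τ) : ∃ N, 0 ≤ N ∧
    ∀ᶠ η in 𝓝 (0 : ℝ), ∀ t, 0 ≤ t →
      |t - S.b / √(2 * S.α * S.b) * τ η t| ≤ N * η ^ 2 * τ η t ∧
      |(c η t).2 - 1 / √(2 * S.α * S.b) * τ η t| ≤ N * η ^ 2 * τ η t := by
  obtain ⟨C, hC, hq⟩ := S.clairaut_defect_isBigO_sq.exists_pos
  set N₁ := |A₁| + |A₂| + M
  set N₂ := |B₁| + |B₂| + M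
  have hM := h.M_nonneg
  have hN₁ : 0 ≤ N₁ := by positivity
  have hN₂ : 0 ≤ N₂ := by positivity
  refine ⟨(N₁ + N₂) * C, by positivity, ?_⟩
  filter_upwards [h.eventually, hq.bound,
    S.tendsto_clairaut_defect.eventually_le_const one_pos] with η ho hqη hq1 t ht
  have hτ := tau_nonneg ho ht
  have hq0 : 0 ≤ S.b - S.b * Real.cos η := by nlinarith [Real.cos_le_one η, S.b_pos]
  rw [Real.norm_of_nonneg hq0, Real.norm_of_nonneg (sq_nonneg η)] at hqη
  have key : ∀ N, 0 ≤ N → N ≤ N₁ + N₂ →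
      N * (S.b - S.b * Real.cos η) * τ η t ≤ (N₁ + N₂) * C * η ^ 2 * τ η t := by
    intro N hN hN'
    refine mul_le_mul_of_nonneg_right ?_ hτ
    rw [mul_assoc]
    exact mul_le_mul hN' hqη hq0 (by positivity)
  exact ⟨(abs_sub_le_of_expansion hτ hq0 hq1 hM (ho.abs_time_sub_le t ht)).trans
      (key _ hN₁ (by linarith)),
    (abs_sub_le_of_expansion hτ hq0 hq1 hM (ho.abs_θ_sub_le t ht)).trans
      (key _ hN₂ (by linarith))⟩

/-- Crude comparisons, valid for all nonnegative times, that are available before the angle is known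
to be close to `π`. -/
theorem eventually_bounds (h : S.OscillationFamily A₁ A₂ B₁ B₂ M c τ) :
    ∀ᶠ η in 𝓝 (0 : ℝ), ∀ t, 0 ≤ t →
      t ≤ 2 * (S.b / √(2 * S.α * S.b)) * τ η t ∧
      S.b / √(2 * S.α * S.b) * τ η t ≤ 2 * t ∧
      1 / √(2 * S.α * S.b) * τ η t ≤ 2 * (c η t).2 := by
  obtain ⟨N, hN, hev⟩ := h.exists_coarse
  have hs := h.sqrt_pos
  have hb := S.b_pos
  have h0 : Tendsto (fun η : ℝ => N * η ^ 2) (𝓝 0) (𝓝 0) := by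
    have : Continuous fun η : ℝ => N * η ^ 2 := by fun_prop
    simpa using this.tendsto 0
  filter_upwards [hev, h.eventually,
    h0.eventually_le_const (by positivity : 0 < S.b / √(2 * S.α * S.b) / 2),
    h0.eventually_le_const (by positivity : 0 < 1 / √(2 * S.α * S.b) / 2)] with η hη ho h1 h2 t ht
  have hτ := tau_nonneg ho ht
  have h3 := abs_le.1 ((hη t ht).1.trans (mul_le_mul_of_nonneg_right h1 hτ))
  have h4 := abs_le.1 ((hη t ht).2.trans (mul_le_mul_of_nonneg_right h2 hτ))
  refine ⟨by linarith, by linarith, by linarith⟩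

theorem eventually_surj (h : S.OscillationFamily A₁ A₂ B₁ B₂ M c τ) :
    ∀ᶠ η in 𝓝 (0 : ℝ), ∀ v, 0 ≤ v → ∃ t, 0 ≤ t ∧ τ η t = v := by
  have hs := h.sqrt_pos
  have hb := S.b_pos
  filter_upwards [h.eventually_bounds, h.eventually] with η hη ho v hv
  set T := 2 * (S.b / √(2 * S.α * S.b)) * v with hT
  have hT0 : 0 ≤ T := by positivity
  have h1 : v ≤ τ η T := by
    have := (hη T hT0).1
    exact le_of_mul_le_mul_left (by linarith) (by positivity : 0 < 2 * (S.b / √(2 * S.α * S.b)))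
  obtain ⟨t, ht, ht'⟩ := intermediate_value_Icc hT0 ho.cont.continuousOn
    (show v ∈ Icc (τ η 0) (τ η T) from ⟨by rw [ho.zero]; exact hv, h1⟩)
  exact ⟨t, ht.1, ht'⟩

/-- The expansion of the longitude at the first return to the equator. -/
theorem φ_isBigO (h : S.OscillationFamily A₁ A₂ B₁ B₂ M c τ) (hm : StrictMonoOn S.m (Icc 0 S.a))
    (hc : ∀ η ∈ Ioo (-(Real.pi / 2)) (Real.pi / 2), S.IsEquatorGeodesic η (c η)) :
    (fun η => S.φ (S.b * Real.cos η) - (S.cutLongitude + S.cubicConst / S.b * η ^ 2))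
      =O[𝓝[>] 0] fun η => η ^ 4 := by
  have hπ := Real.pi_pos
  have hb := S.b_pos
  have hs := h.sqrt_pos
  have hle : 𝓝[>] (0 : ℝ) ≤ 𝓝 0 := nhdsWithin_le_nhds
  set q : ℝ → ℝ := fun η => S.b - S.b * Real.cos η with hq
  have h1 : (fun η => S.φ (S.b * Real.cos η)
      - (S.cutLongitude + q η * (Real.pi * (B₁ + B₂ / 2)))) =O[𝓝[>] 0] fun η => q η ^ 2 := by
    refine IsBigO.of_bound (M * Real.pi) ?_
    filter_upwards [hle h.eventually, hle h.eventually_surj,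
      Ioo_mem_nhdsGT (by positivity : 0 < Real.pi / 2)] with η ho hsurj hη
    obtain ⟨T, hT0, hT⟩ := hsurj (Real.pi / 2) (by positivity)
    rw [ho.φ_eq hm (hc η ⟨by linarith [hη.1], hη.2⟩) hη hT]
    have h2 := ho.abs_θ_sub_le T hT0
    have h3 : (2 : ℝ) * (Real.pi / 2) = Real.pi := by ring
    rw [hT, h3, Real.sin_pi] at h2
    have h4 : 2 * (c η T).2 - (S.cutLongitude + q η * (Real.pi * (B₁ + B₂ / 2)))
        = 2 * ((c η T).2 - (1 / √(2 * S.α * S.b) * (Real.pi / 2) + (S.b - S.b * Real.cos η)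
          * (B₁ * (Real.pi / 2) + B₂ * (Real.pi / 2 / 2 - 0 / 4)))) := by
      simp only [hq, cutLongitude]
      ring
    rw [h4, norm_mul, Real.norm_of_nonneg zero_le_two, Real.norm_eq_abs,
      Real.norm_of_nonneg (sq_nonneg _)]
    linarith
  have h2 : (fun η => q η ^ 2) =O[𝓝 0] fun η => η ^ 4 := by
    have := S.clairaut_defect_isBigO_sq.pow 2
    refine this.congr_right fun η => ?_
    ring
  have h3 := (h1.trans (h2.mono hle)).add
    ((S.clairaut_defect_isBigO.const_mul_left (Real.pi * (B₁ + B₂ / 2))).mono hle)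
  refine h3.congr_left fun η => ?_
  rw [← h.cubic]
  simp only [hq]
  field_simp
  ring

theorem tendsto_φ (h : S.OscillationFamily A₁ A₂ B₁ B₂ M c τ) (hm : StrictMonoOn S.m (Icc 0 S.a))
    (hc : ∀ η ∈ Ioo (-(Real.pi / 2)) (Real.pi / 2), S.IsEquatorGeodesic η (c η)) :
    Tendsto (fun η => S.φ (S.b * Real.cos η)) (𝓝[>] 0) (𝓝 S.cutLongitude) := by
  have hle : 𝓝[>] (0 : ℝ) ≤ 𝓝 0 := nhdsWithin_le_nhds
  have h1 : Tendsto (fun η : ℝ => η ^ 4) (𝓝[>] 0) (𝓝 0) := by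
    have : Continuous fun η : ℝ => η ^ 4 := by fun_prop
    simpa using (this.tendsto 0).mono_left hle
  have h2 : Tendsto (fun η : ℝ => S.cutLongitude + S.cubicConst / S.b * η ^ 2) (𝓝[>] 0)
      (𝓝 S.cutLongitude) := by
    have : Continuous fun η : ℝ => S.cutLongitude + S.cubicConst / S.b * η ^ 2 := by fun_prop
    simpa using (this.tendsto 0).mono_left hle
  simpa using ((h.φ_isBigO hm hc).trans_tendsto h1).add h2

/-- The substitution `η = arccos(ν/b)` sends `ν → b⁻` to `η → 0⁺`. -/
theorem tendsto_φ_left (h : S.OscillationFamily A₁ A₂ B₁ B₂ M c τ)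
    (hm : StrictMonoOn S.m (Icc 0 S.a))
    (hc : ∀ η ∈ Ioo (-(Real.pi / 2)) (Real.pi / 2), S.IsEquatorGeodesic η (c η)) :
    Tendsto S.φ (𝓝[<] S.b) (𝓝 S.cutLongitude) := by
  have hb := S.b_pos
  have h1 : Tendsto (fun ν => Real.arccos (ν / S.b)) (𝓝[<] S.b) (𝓝[>] 0) := by
    refine tendsto_nhdsWithin_iff.2 ⟨?_, ?_⟩
    · have h2 : Continuous fun ν => Real.arccos (ν / S.b) :=
        Real.continuous_arccos.comp (continuous_id.div_const _)
      have := (h2.tendsto S.b).mono_left (nhdsWithin_le_nhds (s := Iio S.b))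
      simpa [div_self hb.ne'] using this
    · filter_upwards [self_mem_nhdsWithin] with ν hν
      exact Real.arccos_pos.2 ((div_lt_one hb).2 hν)
  refine ((h.tendsto_φ hm hc).comp h1).congr' ?_
  filter_upwards [Ioo_mem_nhdsLT hb] with ν hν
  have h2 : ν / S.b ≤ 1 := (div_le_one hb).2 hν.2.le
  have h3 : -1 ≤ ν / S.b := by
    have : 0 < ν / S.b := div_pos hν.1 hb
    linarith
  simp only [Function.comp]
  rw [Real.cos_arccos h3 h2, mul_div_cancel₀ _ hb.ne']

end OscillationFamily


/-! ### Expansions where the angle is close to `π` -/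

variable {S : TwoSphereOfRevolution}

namespace OscillationFamily

variable {A₁ A₂ B₁ B₂ M : ℝ} {c : ℝ → ℝ → ℝ × ℝ} {τ : ℝ → ℝ → ℝ} {L : Filter (ℝ × ℝ)}

theorem pow_isBigO_pow (hL : Tendsto Prod.fst L (𝓝 (0 : ℝ))) {m n : ℕ} (h : m ≤ n) :
    (fun i : ℝ × ℝ => i.1 ^ n) =O[L] fun i => i.1 ^ m := by
  refine IsBigO.of_bound 1 ?_
  filter_upwards [hL.eventually (Metric.ball_mem_nhds (0 : ℝ) one_pos)] with i hi
  rw [one_mul, norm_pow, norm_pow]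
  exact pow_le_pow_of_le_one (norm_nonneg _) (mem_ball_zero_iff.1 hi).le h

theorem sin_sub_isBigO : (fun u : ℝ => Real.sin u - u) =O[𝓝 0] fun u => u ^ 2 := by
  have := (Real.contDiff_sin (n := 2)).contDiffAt (x := 0) |>.isBigO_sub_taylor_one
  simpa using this

theorem tendsto_sub_pi (hL : Tendsto Prod.fst L (𝓝 (0 : ℝ)))
    (hτ : (fun i => τ i.1 i.2 - Real.pi) =O[L] fun i => i.1 ^ 2) :
    Tendsto (fun i => τ i.1 i.2 - Real.pi) L (𝓝 0) :=
  hτ.trans_tendsto (tendsto_sq_zero.comp hL)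

/-- With `τ = π + O(η²)` the term `sin 2τ` is `O(η²)` and carries a factor `q = O(η²)`, so it joins
the error; in the same way `q` may be replaced by `b η²/2` and `τ` by `π` in the correction. Time
and longitude are both instances. -/
theorem expansion_isBigO (hL : Tendsto Prod.fst L (𝓝 (0 : ℝ)))
    (hτ : (fun i => τ i.1 i.2 - Real.pi) =O[L] fun i => i.1 ^ 2) {f : ℝ × ℝ → ℝ} {Y₀ Y₁ Y₂ M : ℝ}
    (hf : ∀ᶠ i in L, |f i - (Y₀ * τ i.1 i.2 + (S.b - S.b * Real.cos i.1) *
      (Y₁ * τ i.1 i.2 + Y₂ * (τ i.1 i.2 / 2 - Real.sin (2 * τ i.1 i.2) / 4)))|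
      ≤ M * (S.b - S.b * Real.cos i.1) ^ 2 * τ i.1 i.2) :
    (fun i => f i - (Y₀ * τ i.1 i.2 + (S.b / 2 * i.1 ^ 2) * (Real.pi * (Y₁ + Y₂ / 2)))) =O[L]
      fun i => i.1 ^ 4 := by
  have hu0 := tendsto_sub_pi hL hτ
  have hτ0 : Tendsto (fun i => τ i.1 i.2) L (𝓝 Real.pi) := by
    simpa using hu0.add_const Real.pi
  have hq : (fun i : ℝ × ℝ => S.b - S.b * Real.cos i.1) =O[L] fun i => i.1 ^ 2 :=
    S.clairaut_defect_isBigO_sq.comp_tendsto hL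
  have hq2 : (fun i : ℝ × ℝ => S.b - S.b * Real.cos i.1 - S.b / 2 * i.1 ^ 2) =O[L]
      fun i => i.1 ^ 4 := S.clairaut_defect_isBigO.comp_tendsto hL
  have h1 : (fun i => f i - (Y₀ * τ i.1 i.2 + (S.b - S.b * Real.cos i.1) *
      (Y₁ * τ i.1 i.2 + Y₂ * (τ i.1 i.2 / 2 - Real.sin (2 * τ i.1 i.2) / 4)))) =O[L]
      fun i => i.1 ^ 4 := by
    have h2 : (fun i => M * (S.b - S.b * Real.cos i.1) ^ 2 * τ i.1 i.2) =O[L]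
        fun i => i.1 ^ 4 := by
      have := ((hq.pow 2).const_mul_left M).mul (hτ0.isBigO_one ℝ)
      refine this.congr_right fun i => ?_
      ring
    refine IsBigO.trans (IsBigO.of_bound 1 ?_) h2
    filter_upwards [hf] with i hi
    rw [one_mul]
    exact hi.trans (le_abs_self _)
  have h3 : (fun i => Real.sin (2 * τ i.1 i.2)) =O[L] fun i => i.1 ^ 2 := by
    have h4 : (fun i => Real.sin (2 * τ i.1 i.2)) =O[L] fun i => τ i.1 i.2 - Real.pi := by
      refine IsBigO.of_bound 2 (Eventually.of_forall fun i => ?_)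
      have h5 : Real.sin (2 * τ i.1 i.2) = Real.sin (2 * (τ i.1 i.2 - Real.pi)) := by
        rw [← Real.sin_sub_two_pi]
        congr 1
        ring
      rw [h5, Real.norm_eq_abs, Real.norm_eq_abs]
      refine Real.abs_sin_le_abs.trans ?_
      rw [abs_mul, abs_two]
    exact h4.trans hτ
  have h6 : (fun i => (S.b - S.b * Real.cos i.1) * ((Y₁ + Y₂ / 2) * (τ i.1 i.2 - Real.pi)
      - Y₂ / 4 * Real.sin (2 * τ i.1 i.2))) =O[L] fun i => i.1 ^ 4 := by
    have := hq.mul ((hτ.const_mul_left (Y₁ + Y₂ / 2)).sub (h3.const_mul_left (Y₂ / 4)))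
    refine this.congr_right fun i => ?_
    ring
  refine ((h1.add h6).add (hq2.const_mul_left (Real.pi * (Y₁ + Y₂ / 2)))).congr_left fun i => ?_
  ring

theorem amplitude_isBigO_fst (hL : Tendsto Prod.fst L (𝓝 (0 : ℝ))) :
    (fun i : ℝ × ℝ => √(2 * S.b) * Real.sin (i.1 / 2)) =O[L] fun i => i.1 := by
  have h1 : (fun i : ℝ × ℝ => √(2 * S.b) * Real.sin (i.1 / 2) - √(S.b / 2) * i.1) =O[L]
      fun i => i.1 ^ 3 := S.amplitude_isBigO.comp_tendsto hL
  have h2 : (fun i : ℝ × ℝ => i.1 ^ 3) =O[L] fun i => i.1 := by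
    simpa using pow_isBigO_pow hL (m := 1) (n := 3) (by norm_num)
  have := (h1.trans h2).add ((isBigO_refl (fun i : ℝ × ℝ => i.1) L).const_mul_left (√(S.b / 2)))
  refine this.congr_left fun i => ?_
  ring

/-- The distance to the equator close to the first return. -/
theorem height_isBigO (h : S.OscillationFamily A₁ A₂ B₁ B₂ M c τ)
    (hL : Tendsto Prod.fst L (𝓝 (0 : ℝ)))
    (hτ : (fun i => τ i.1 i.2 - Real.pi) =O[L] fun i => i.1 ^ 2) :
    (fun i => S.a - (c i.1 i.2).1 + √(S.b / 2) / √S.α * i.1 * (τ i.1 i.2 - Real.pi)) =O[L]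
      fun i => i.1 ^ 4 := by
  have hu0 := tendsto_sub_pi hL hτ
  have hρ := amplitude_isBigO_fst (S := S) hL
  have hq : (fun i : ℝ × ℝ => S.b - S.b * Real.cos i.1) =O[L] fun i => i.1 ^ 2 :=
    S.clairaut_defect_isBigO_sq.comp_tendsto hL
  have hsin : ∀ i : ℝ × ℝ, Real.sin (τ i.1 i.2) = -Real.sin (τ i.1 i.2 - Real.pi) := fun i => by
    rw [Real.sin_sub_pi, neg_neg]
  -- The crude remainder `O((τ - π)²)` of the sine is already `O(η⁴)`.
  have h1 : (fun i => Real.sin (τ i.1 i.2) + (τ i.1 i.2 - Real.pi)) =O[L] fun i => i.1 ^ 4 := by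
    have h2 := (sin_sub_isBigO.comp_tendsto hu0).neg_left.trans (hτ.pow 2)
    refine h2.congr (fun i => ?_) fun i => ?_
    · rw [hsin]
      simp only [Function.comp]
      ring
    · ring
  have h1' : (fun i => Real.sin (τ i.1 i.2)) =O[L] fun i => i.1 ^ 2 := by
    refine ((h1.trans (pow_isBigO_pow hL (by norm_num : 2 ≤ 4))).sub hτ).congr_left fun i => ?_
    ring
  have h3 : (fun i => S.a - (c i.1 i.2).1 - √(2 * S.b) * Real.sin (i.1 / 2)
      * Real.sin (τ i.1 i.2) / √S.α) =O[L] fun i => i.1 ^ 4 := by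
    have h4 : (fun i => (S.b - S.b * Real.cos i.1) * (√(2 * S.b) * Real.sin (i.1 / 2)
        * Real.sin (τ i.1 i.2))) =O[L] fun i => i.1 ^ 4 := by
      refine ((hq.mul (hρ.mul h1')).congr_right fun i => ?_).trans
        (pow_isBigO_pow hL (by norm_num : 4 ≤ 5))
      ring
    refine IsBigO.trans (IsBigO.of_bound M ?_) h4
    filter_upwards [hL.eventually h.eventually] with i hi
    have hq0 : 0 ≤ S.b - S.b * Real.cos i.1 := by nlinarith [Real.cos_le_one i.1, S.b_pos]
    rw [norm_mul, Real.norm_of_nonneg hq0, ← mul_assoc]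
    exact hi.abs_r_sub_le i.2
  have h5 : (fun i => √(2 * S.b) * Real.sin (i.1 / 2) / √S.α *
      (Real.sin (τ i.1 i.2) + (τ i.1 i.2 - Real.pi))) =O[L] fun i => i.1 ^ 4 := by
    refine (((hρ.const_mul_left (1 / √S.α)).mul h1).congr (fun i => ?_) fun i => ?_).trans
        (pow_isBigO_pow hL (by norm_num : 4 ≤ 5))
    · ring
    · ring
  have h6 : (fun i => (√(2 * S.b) * Real.sin (i.1 / 2) - √(S.b / 2) * i.1) / √S.α *
      (τ i.1 i.2 - Real.pi)) =O[L] fun i => i.1 ^ 4 := by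
    refine ((((S.amplitude_isBigO.comp_tendsto hL).const_mul_left (1 / √S.α)).mul hτ).congr
      (fun i => ?_) fun i => ?_).trans (pow_isBigO_pow hL (by norm_num : 4 ≤ 5))
    · simp only [Function.comp]
      ring
    · simp only [Function.comp]
      ring
  refine ((h3.add h5).sub h6).congr_left fun i => ?_
  ring

theorem longitude_isBigO (h : S.OscillationFamily A₁ A₂ B₁ B₂ M c τ)
    (hL : Tendsto Prod.fst L (𝓝 (0 : ℝ))) (hL' : ∀ᶠ i in L, 0 ≤ i.2)
    (hτ : (fun i => τ i.1 i.2 - Real.pi) =O[L] fun i => i.1 ^ 2) :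
    (fun i => (c i.1 i.2).2 - S.cutLongitude - (1 / √(2 * S.α * S.b) * (τ i.1 i.2 - Real.pi)
      + S.cubicConst / S.b * i.1 ^ 2)) =O[L] fun i => i.1 ^ 4 := by
  have h1 := expansion_isBigO (S := S) hL hτ (f := fun i => (c i.1 i.2).2)
    (Y₀ := 1 / √(2 * S.α * S.b)) (Y₁ := B₁) (Y₂ := B₂) (M := M) (by
      filter_upwards [hL.eventually h.eventually, hL'] with i hi hi'
      exact hi.abs_θ_sub_le i.2 hi')
  refine h1.congr_left fun i => ?_
  have := S.b_pos.ne'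
  rw [← h.cubic, cutLongitude]
  field_simp
  ring

theorem time_isBigO (h : S.OscillationFamily A₁ A₂ B₁ B₂ M c τ)
    (hL : Tendsto Prod.fst L (𝓝 (0 : ℝ))) (hL' : ∀ᶠ i in L, 0 ≤ i.2)
    (hτ : (fun i => τ i.1 i.2 - Real.pi) =O[L] fun i => i.1 ^ 2) :
    (fun i => i.2 - S.b * S.cutLongitude - (S.b / √(2 * S.α * S.b) * (τ i.1 i.2 - Real.pi)
      + S.b / 2 * (Real.pi * (A₁ + A₂ / 2)) * i.1 ^ 2)) =O[L] fun i => i.1 ^ 4 := by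
  have h1 := expansion_isBigO (S := S) hL hτ (f := fun i => i.2)
    (Y₀ := S.b / √(2 * S.α * S.b)) (Y₁ := A₁) (Y₂ := A₂) (M := M) (by
      filter_upwards [hL.eventually h.eventually, hL'] with i hi hi'
      exact hi.abs_time_sub_le i.2 hi')
  refine h1.congr_left fun i => ?_
  rw [cutLongitude]
  ring

/-- Inverts the coarse estimate `f ≈ Y₀ τ`. Convergence of `f` first bounds `τ`, since `N η² ≤ Y₀/2`
eventually; then the error `N η² τ` is `O(η²)`. -/
theorem angle_isBigO {N Y₀ : ℝ} (hY : 0 < Y₀) {f : ℝ × ℝ → ℝ}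
    (hL : Tendsto Prod.fst L (𝓝 (0 : ℝ))) (hτ : ∀ᶠ i in L, 0 ≤ τ i.1 i.2)
    (hf : ∀ᶠ i in L, |f i - Y₀ * τ i.1 i.2| ≤ N * i.1 ^ 2 * τ i.1 i.2)
    (hf' : (fun i => f i - Y₀ * Real.pi) =O[L] fun i => i.1 ^ 2) :
    (fun i => τ i.1 i.2 - Real.pi) =O[L] fun i => i.1 ^ 2 := by
  have hη : Tendsto (fun i : ℝ × ℝ => i.1 ^ 2) L (𝓝 0) := tendsto_sq_zero.comp hL
  have hf0 : Tendsto f L (𝓝 (Y₀ * Real.pi)) := by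
    simpa using (hf'.trans_tendsto hη).add_const (Y₀ * Real.pi)
  have h1 : (fun i => τ i.1 i.2) =O[L] fun _ => (1 : ℝ) := by
    refine IsBigO.trans (IsBigO.of_bound (2 / Y₀) ?_) (hf0.isBigO_one ℝ)
    have h2 : Tendsto (fun i : ℝ × ℝ => N * i.1 ^ 2) L (𝓝 0) := by
      simpa using hη.const_mul N
    filter_upwards [hτ, hf, h2.eventually_le_const (half_pos hY)] with i h3 h4 h5
    have h6 := (abs_le.1 (h4.trans (mul_le_mul_of_nonneg_right h5 h3))).1
    have h7 := le_abs_self (f i)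
    rw [Real.norm_of_nonneg h3, Real.norm_eq_abs, div_mul_eq_mul_div, le_div_iff₀ hY]
    linarith
  have h2 : (fun i => f i - Y₀ * τ i.1 i.2) =O[L] fun i => i.1 ^ 2 := by
    have h3 : (fun i => N * i.1 ^ 2 * τ i.1 i.2) =O[L] fun i => i.1 ^ 2 := by
      simpa using ((isBigO_refl (fun i : ℝ × ℝ => i.1 ^ 2) L).const_mul_left N).mul h1
    refine IsBigO.trans (IsBigO.of_bound 1 ?_) h3
    filter_upwards [hf] with i hi
    rw [one_mul]
    exact hi.trans (le_abs_self _)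
  refine ((hf'.sub h2).const_mul_left (1 / Y₀)).congr_left fun i => ?_
  field_simp
  ring

theorem angle_isBigO_of_time (h : S.OscillationFamily A₁ A₂ B₁ B₂ M c τ)
    (hL : Tendsto Prod.fst L (𝓝 (0 : ℝ))) (hL' : ∀ᶠ i in L, 0 ≤ i.2)
    (ht : (fun i : ℝ × ℝ => i.2 - S.b * S.cutLongitude) =O[L] fun i => i.1 ^ 2) :
    (fun i => τ i.1 i.2 - Real.pi) =O[L] fun i => i.1 ^ 2 := by
  obtain ⟨N, -, hN⟩ := h.exists_coarse
  refine angle_isBigO (N := N) (div_pos S.b_pos h.sqrt_pos) hL (f := fun i => i.2) ?_ ?_ ?_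
  · filter_upwards [hL.eventually h.eventually, hL'] with i hi hi' using tau_nonneg hi hi'
  · filter_upwards [hL.eventually hN, hL'] with i hi hi' using (hi i.2 hi').1
  · refine ht.congr_left fun i => ?_
    rw [cutLongitude]
    ring

theorem angle_isBigO_of_longitude (h : S.OscillationFamily A₁ A₂ B₁ B₂ M c τ)
    (hL : Tendsto Prod.fst L (𝓝 (0 : ℝ))) (hL' : ∀ᶠ i in L, 0 ≤ i.2)
    (ht : (fun i : ℝ × ℝ => (c i.1 i.2).2 - S.cutLongitude) =O[L] fun i => i.1 ^ 2) :
    (fun i => τ i.1 i.2 - Real.pi) =O[L] fun i => i.1 ^ 2 := by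
  obtain ⟨N, -, hN⟩ := h.exists_coarse
  refine angle_isBigO (N := N) (div_pos one_pos h.sqrt_pos) hL (f := fun i => (c i.1 i.2).2) ?_ ?_ ?_
  · filter_upwards [hL.eventually h.eventually, hL'] with i hi hi' using tau_nonneg hi hi'
  · filter_upwards [hL.eventually hN, hL'] with i hi hi' using (hi i.2 hi').2
  · refine ht.congr_left fun i => ?_
    rw [cutLongitude]
    ring

/-- Where the longitude is close to that of the cut-conjugate point, the distance to the equator
is `C η³ + O(η⁴)`. -/
theorem exists_height_bound (h : S.OscillationFamily A₁ A₂ B₁ B₂ M c τ) (K : ℝ) :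
    ∃ M', 0 ≤ M' ∧ ∀ᶠ η in 𝓝 (0 : ℝ), ∀ t, 0 ≤ t → |(c η t).2 - S.cutLongitude| ≤ K * |η| ^ 3 →
      |S.a - (c η t).1 - S.cubicConst * η ^ 3| ≤ M' * η ^ 4 := by
  set s : Set (ℝ × ℝ) := {i | 0 ≤ i.2 ∧ |(c i.1 i.2).2 - S.cutLongitude| ≤ K * |i.1| ^ 3} with hs
  -- Restricting the uniform filter to the admissible pairs `(η, t)` makes the resulting bound
  -- uniform over them.
  set L : Filter (ℝ × ℝ) := (𝓝 0 ×ˢ ⊤) ⊓ 𝓟 s with hLdef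
  have hL : Tendsto Prod.fst L (𝓝 (0 : ℝ)) := tendsto_fst.mono_left inf_le_left
  have hLs : ∀ᶠ i in L, i ∈ s := mem_inf_of_right (mem_principal_self s)
  have hL' : ∀ᶠ i in L, 0 ≤ i.2 := hLs.mono fun i hi => hi.1
  have h3 : (fun i : ℝ × ℝ => (c i.1 i.2).2 - S.cutLongitude) =O[L] fun i => i.1 ^ 3 := by
    refine IsBigO.of_bound K ?_
    filter_upwards [hLs] with i hi
    rw [norm_pow]
    exact hi.2
  have hτ := h.angle_isBigO_of_longitude hL hL' (h3.trans (pow_isBigO_pow hL (by norm_num)))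
  have hb := S.b_pos
  have hsq := h.sqrt_pos
  have hα := h.α_pos
  have h4 := ((h3.sub ((h.longitude_isBigO hL hL' hτ).trans (pow_isBigO_pow hL (by norm_num)))))
  have h5 := (isBigO_refl (fun i : ℝ × ℝ => i.1) L).mul (h4.const_mul_left S.b)
  have h6 : (fun i => S.a - (c i.1 i.2).1 - S.cubicConst * i.1 ^ 3) =O[L] fun i => i.1 ^ 4 := by
    refine ((h.height_isBigO hL hτ).sub (h5.congr_right fun i => ?_)).congr_left fun i => ?_
    · ring
    -- This equality of coefficients lets `b η` times the longitude expansion cancel `τ - π` in the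
    -- height, leaving `C η³`.
    · have h7 : √(S.b / 2) / √S.α = S.b / √(2 * S.α * S.b) := by
        have h8 : √S.b ^ 2 = S.b := Real.sq_sqrt hb.le
        have h9 : √(2 * S.α * S.b) = √2 * √S.α * √S.b := by
          rw [Real.sqrt_mul (by positivity), Real.sqrt_mul (by positivity)]
        have h10 : 0 < √S.α := Real.sqrt_pos.2 hα
        have h11 : 0 < √S.b := Real.sqrt_pos.2 hb
        rw [h9, Real.sqrt_div hb.le]
        field_simp
        exact h8
      rw [h7]
      field_simp
      ring
  obtain ⟨C, hC, hbound⟩ := h6.exists_pos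
  refine ⟨C, hC.le, ?_⟩
  have h7 := hbound.bound
  rw [hLdef, eventually_inf_principal] at h7
  filter_upwards [h7.curry] with η hη t ht ht'
  rw [eventually_top] at hη
  have := hη t ⟨ht, ht'⟩
  rwa [Real.norm_eq_abs, norm_pow, Real.norm_eq_abs, Even.pow_abs (by decide)] at this

end OscillationFamily


variable {S : TwoSphereOfRevolution}

/-! ### Distances to the cut-conjugate point -/

theorem cutLongitude_pos (hα : 0 < S.α) : 0 < S.cutLongitude := by
  have := S.b_pos
  have := Real.pi_pos
  rw [cutLongitude]
  positivity

theorem cutLongitude_le_pi (h : 1 ≤ 2 * S.α * S.b) : S.cutLongitude ≤ Real.pi := by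
  rw [cutLongitude]
  exact div_le_self Real.pi_pos.le (Real.one_le_sqrt.2 h)

theorem mem_Icc_of_geodesic {η : ℝ} {c : ℝ → ℝ × ℝ} (h : S.IsEquatorGeodesic η c) (t : ℝ) :
    (c t).1 ∈ Icc 0 (2 * S.a) :=
  Ioo_subset_Icc_self (h.geodesic.mem t)

theorem eventually_half_b_le {c : ℝ → ℝ → ℝ × ℝ}
    (hc : ∀ η ∈ Ioo (-(Real.pi / 2)) (Real.pi / 2), S.IsEquatorGeodesic η (c η)) :
    ∀ᶠ η in 𝓝 (0 : ℝ), ∀ t, S.b / 2 ≤ S.m (c η t).1 := by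
  filter_upwards [eventually_mem_Ioo_pi,
    S.tendsto_clairaut_defect.eventually_le_const (half_pos S.b_pos)] with η hη h t
  linarith [(hc η hη).clairaut_le_m t]

namespace OscillationFamily

variable {A₁ A₂ B₁ B₂ M : ℝ} {c : ℝ → ℝ → ℝ × ℝ} {τ : ℝ → ℝ → ℝ}

/-- If the distance is below `C|η|³`, the longitude is `θcut + O(η³)`, so the height is `C η³ +
O(η⁴)`; and the distance is at least the absolute height. -/
theorem exists_rdist_lower_bound (h : S.OscillationFamily A₁ A₂ B₁ B₂ M c τ)
    (hc : ∀ η ∈ Ioo (-(Real.pi / 2)) (Real.pi / 2), S.IsEquatorGeodesic η (c η))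
    (hC : 0 ≤ S.cubicConst) :
    ∃ M', 0 ≤ M' ∧ ∀ᶠ η in 𝓝 (0 : ℝ), ∀ t, 0 ≤ t →
      |(c η t).2 - S.cutLongitude| ≤ 3 * Real.pi / 2 →
      S.cubicConst * |η| ^ 3 - M' * η ^ 4 ≤ S.rdist (c η t) (S.a, S.cutLongitude) := by
  obtain ⟨K, κ, hK, hκ, hlow⟩ := S.exists_abs_sub_snd_le_rdist
  obtain ⟨M', hM', hheight⟩ := h.exists_height_bound (K * S.cubicConst)
  refine ⟨M', hM', ?_⟩
  have h0 : Tendsto (fun η : ℝ => S.cubicConst * |η| ^ 3) (𝓝 0) (𝓝 0) := by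
    have : Continuous fun η : ℝ => S.cubicConst * |η| ^ 3 := by fun_prop
    simpa using this.tendsto 0
  filter_upwards [hheight, eventually_half_b_le hc, eventually_mem_Ioo_pi,
    h0.eventually_lt_const hκ] with η hη hm hmem hκη t ht hθ
  have hr := mem_Icc_of_geodesic (hc η hmem) t
  rcases le_or_gt (S.cubicConst * |η| ^ 3) (S.rdist (c η t) (S.a, S.cutLongitude)) with hd | hd
  · have : 0 ≤ M' * η ^ 4 := by positivity
    linarith
  · have h1 := hlow (c η t) S.cutLongitude hr (hm t) hθ (hd.trans hκη)
    have h2 := hη t ht (by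
      rw [mul_assoc]
      exact h1.trans (mul_le_mul_of_nonneg_left hd.le hK.le))
    have h3 := abs_sub_fst_le_rdist (S := S) (P := c η t) (Q := (S.a, S.cutLongitude)) hr
      ⟨S.a_pos.le, by linarith [S.a_pos]⟩
    rw [abs_sub_comm] at h3
    have h4 : S.cubicConst * |η| ^ 3 = |S.cubicConst * η ^ 3| := by
      rw [abs_mul, abs_pow, abs_of_nonneg hC]
    have h5 := abs_sub_abs_le_abs_sub (S.cubicConst * η ^ 3) (S.a - (c η t).1)
    rw [abs_sub_comm (S.cubicConst * η ^ 3)] at h5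
    simp only at h3
    rw [h4]
    linarith

/-- Time and longitude agree up to the factor `b` and an error `O(η²)`. -/
theorem exists_time_longitude (h : S.OscillationFamily A₁ A₂ B₁ B₂ M c τ) :
    ∃ N, 0 ≤ N ∧ ∀ᶠ η in 𝓝 (0 : ℝ), ∀ t, 0 ≤ t → |t - S.b * (c η t).2| ≤ N * η ^ 2 * t := by
  obtain ⟨N, hN, hev⟩ := h.exists_coarse
  have hs := h.sqrt_pos
  have hb := S.b_pos
  set A := S.b / √(2 * S.α * S.b) with hA
  have hA0 : 0 < A := div_pos hb hs
  refine ⟨(N + S.b * N) * (2 / A), by positivity, ?_⟩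
  filter_upwards [hev, h.eventually_bounds] with η hη hη' t ht
  obtain ⟨h1, h2⟩ := hη t ht
  have h3 := (hη' t ht).2.1
  have h4 : τ η t ≤ 2 / A * t := by
    rw [div_mul_eq_mul_div, le_div_iff₀ hA0]
    linarith
  have h5 : t - S.b * (c η t).2 = (t - A * τ η t)
      - S.b * ((c η t).2 - 1 / √(2 * S.α * S.b) * τ η t) := by
    rw [hA]; ring
  rw [h5]
  refine (abs_sub _ _).trans ?_
  rw [abs_mul, abs_of_pos hb]
  calc _ ≤ N * η ^ 2 * τ η t + S.b * (N * η ^ 2 * τ η t) :=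
        add_le_add h1 (mul_le_mul_of_nonneg_left h2 hb.le)
    _ = (N + S.b * N) * η ^ 2 * τ η t := by ring
    _ ≤ (N + S.b * N) * η ^ 2 * (2 / A * t) := mul_le_mul_of_nonneg_left h4 (by positivity)
    _ = _ := by ring

theorem eventually_exists_longitude_eq (h : S.OscillationFamily A₁ A₂ B₁ B₂ M c τ)
    (hc : ∀ η ∈ Ioo (-(Real.pi / 2)) (Real.pi / 2), S.IsEquatorGeodesic η (c η)) :
    ∀ᶠ η in 𝓝 (0 : ℝ), ∀ v, 0 ≤ v → ∃ t, 0 ≤ t ∧ (c η t).2 = v := by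
  obtain ⟨N, hN, hev⟩ := h.exists_time_longitude
  have hb := S.b_pos
  have h0 : Tendsto (fun η : ℝ => N * η ^ 2) (𝓝 0) (𝓝 0) := by
    simpa using tendsto_sq_zero.const_mul N
  filter_upwards [hev, eventually_mem_Ioo_pi, h0.eventually_le_const (half_pos one_pos)]
    with η hη hmem hN' v hv
  have hT : 0 ≤ 2 * S.b * v := by positivity
  have h1 := (abs_le.1 ((hη _ hT).trans (mul_le_mul_of_nonneg_right hN' hT))).2
  have h2 : v ≤ (c η (2 * S.b * v)).2 :=
    le_of_mul_le_mul_left (by linarith) hb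
  obtain ⟨t, ht, ht'⟩ := intermediate_value_Icc hT
    ((hc η hmem).geodesic.smooth_θ.continuous.continuousOn)
    (show v ∈ Icc (c η 0).2 (c η (2 * S.b * v)).2 from ⟨by rw [(hc η hmem).start]; exact hv, h2⟩)
  exact ⟨t, ht.1, ht'⟩

/-! ### Variations of the equatorial geodesic -/

theorem exists_variation (h : S.OscillationFamily A₁ A₂ B₁ B₂ M c τ)
    (hc : ∀ η ∈ Ioo (-(Real.pi / 2)) (Real.pi / 2), S.IsEquatorGeodesic η (c η)) :
    ∃ (ε : ℝ) (η t : ℝ → ℝ), IsVariation (S.b * S.cutLongitude) ε η t ∧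
      (fun s => S.rdist (c (η s) (t s)) (S.a, S.cutLongitude)) =O[𝓝 0] fun s => s ^ 3 := by
  have hb := S.b_pos
  have hs := h.sqrt_pos
  have hπ := Real.pi_pos
  -- The quadratic coefficient is the one that puts `τ - π` at `-√(2αb) (C/b) s²` to leading order.
  -- The longitude then differs from `θcut` by `O(s⁴)` only, leaving the height, of order `s³`.
  set T : ℝ → ℝ := fun s => S.b * S.cutLongitude
    + (S.b / 2 * (Real.pi * (A₁ + A₂ / 2)) - S.cubicConst) * s ^ 2 with hT
  refine ⟨Real.pi / 2, fun s => s, T, ⟨by positivity, contDiffOn_id, ?_, fun s hs => hs, rfl, ?_,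
    Or.inl (by simp)⟩, ?_⟩
  · exact ContDiff.contDiffOn (by fun_prop)
  · simp [hT]
  -- The image filter carries the two-parameter expansions over to the curve `s ↦ (s, T s)`.
  set L : Filter (ℝ × ℝ) := map (fun s => (s, T s)) (𝓝 0) with hLdef
  have hL : Tendsto Prod.fst L (𝓝 (0 : ℝ)) := by
    rw [hLdef, tendsto_map'_iff]
    exact tendsto_id
  have hTc : Continuous T := by fun_prop
  have hL' : ∀ᶠ i in L, 0 ≤ i.2 := by
    rw [hLdef, eventually_map]
    refine hTc.continuousAt.eventually_const_le ?_
    simp only [hT]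
    have := cutLongitude_pos h.α_pos
    simp only [ne_eq, OfNat.ofNat_ne_zero, not_false_eq_true, zero_pow, mul_zero, add_zero]
    positivity
  have hsecond : ∀ᶠ i in L, i.2 = T i.1 := by
    rw [hLdef, eventually_map]
    exact Eventually.of_forall fun _ => rfl
  have ht : (fun i : ℝ × ℝ => i.2 - S.b * S.cutLongitude) =O[L] fun i => i.1 ^ 2 := by
    refine ((isBigO_refl (fun i : ℝ × ℝ => i.1 ^ 2) L).const_mul_left
      (S.b / 2 * (Real.pi * (A₁ + A₂ / 2)) - S.cubicConst)).congr' ?_ EventuallyEq.rfl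
    filter_upwards [hsecond] with i hi
    rw [hi]
    simp only [hT]
    rw [add_sub_cancel_left]
  have hτ := h.angle_isBigO_of_time hL hL' ht
  have hθ : (fun i : ℝ × ℝ => (c i.1 i.2).2 - S.cutLongitude) =O[L] fun i => i.1 ^ 3 := by
    have h1 := (h.longitude_isBigO hL hL' hτ).add
      ((h.time_isBigO hL hL' hτ).const_mul_left (-1 / S.b))
    refine (h1.congr' ?_ EventuallyEq.rfl).trans (pow_isBigO_pow hL (by norm_num))
    filter_upwards [hsecond] with i hi
    rw [hi]
    simp only [hT]
    field_simp
    ring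
  have hr : (fun i : ℝ × ℝ => (c i.1 i.2).1 - S.a) =O[L] fun i => i.1 ^ 3 := by
    have h1 : (fun i : ℝ × ℝ => √(S.b / 2) / √S.α * i.1 * (τ i.1 i.2 - Real.pi)) =O[L]
        fun i => i.1 ^ 3 := by
      refine ((((isBigO_refl (fun i : ℝ × ℝ => i.1) L).const_mul_left
        (√(S.b / 2) / √S.α)).mul hτ)).congr_right fun i => ?_
      ring
    refine (h1.sub ((h.height_isBigO hL hτ).trans
      (pow_isBigO_pow hL (by norm_num : 3 ≤ 4)))).congr_left fun i => ?_
    ring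
  have hd : (fun i : ℝ × ℝ => S.rdist (c i.1 i.2) (S.a, S.cutLongitude)) =O[L]
      fun i => i.1 ^ 3 := by
    refine IsBigO.trans (IsBigO.of_bound 1 ?_) (hr.norm_left.add (hθ.norm_left.const_mul_left S.b))
    filter_upwards [hL.eventually eventually_mem_Ioo_pi] with i hi
    rw [one_mul, Real.norm_of_nonneg (rdist_nonneg _ _)]
    refine (rdist_le (mem_Icc_of_geodesic (hc i.1 hi) i.2)).trans ?_
    exact le_abs_self _
  rw [hLdef, isBigO_map] at hd
  exact hd

theorem hasDerivAt_eq_zero_of_isLittleO {f : ℝ → ℝ} {f' : ℝ} (hf : HasDerivAt f f' 0)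
    (h : (fun s => f s - f 0) =o[𝓝[>] 0] fun s => s) : f' = 0 := by
  have h1 : HasDerivWithinAt f 0 (Ioi 0) 0 := by
    rw [hasDerivWithinAt_iff_isLittleO]
    simpa using h
  exact (uniqueDiffWithinAt_Ioi 0).eq_deriv _ hf.hasDerivWithinAt h1

/-- For `C > 0` the lower bound gives `η³ = O(f) = o(s³)` with `f` the distance, so `η'(0) = 0`. The
longitude error is `O(f)` and time is `b` times longitude up to `O(η²)`, so `t'(0) = 0` as well,
against regularity. One-sided derivatives are enough. -/
theorem not_exists_variation (h : S.OscillationFamily A₁ A₂ B₁ B₂ M c τ)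
    (hc : ∀ η ∈ Ioo (-(Real.pi / 2)) (Real.pi / 2), S.IsEquatorGeodesic η (c η))
    (hC : 0 < S.cubicConst) :
    ¬ ∃ (ε : ℝ) (η t : ℝ → ℝ), IsVariation (S.b * S.cutLongitude) ε η t ∧
      (fun s => S.rdist (c (η s) (t s)) (S.a, S.cutLongitude)) =o[𝓝[>] 0] fun s => s ^ 3 := by
  rintro ⟨ε, η, t, hv, ho⟩
  have hb := S.b_pos
  have hπ := Real.pi_pos
  have hI : Ioo (-ε) ε ∈ 𝓝 (0 : ℝ) := Ioo_mem_nhds (by linarith [hv.eps_pos]) hv.eps_pos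
  have hη : HasDerivAt η (deriv η 0) 0 :=
    ((hv.smooth_η.contDiffAt hI).differentiableAt (by simp)).hasDerivAt
  have ht : HasDerivAt t (deriv t 0) 0 :=
    ((hv.smooth_t.contDiffAt hI).differentiableAt (by simp)).hasDerivAt
  have hle : 𝓝[>] (0 : ℝ) ≤ 𝓝 0 := nhdsWithin_le_nhds
  have hη0 : Tendsto η (𝓝[>] 0) (𝓝 0) := by
    simpa [hv.η_zero] using hη.continuousAt.tendsto.mono_left hle
  have ht0 : Tendsto t (𝓝[>] 0) (𝓝 (S.b * S.cutLongitude)) := by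
    simpa [hv.t_zero] using ht.continuousAt.tendsto.mono_left hle
  have hs3 : (fun s : ℝ => s ^ 3) =O[𝓝[>] 0] fun s => s := by
    have := (isBigO_refl (fun s : ℝ => s) (𝓝[>] 0)).mul
      ((tendsto_sq_zero.mono_left hle).isBigO_one ℝ)
    refine this.congr (fun s => ?_) fun s => ?_ <;> ring
  set f : ℝ → ℝ := fun s => S.rdist (c (η s) (t s)) (S.a, S.cutLongitude) with hf
  have hfo : f =o[𝓝[>] 0] fun s => s := ho.trans_isBigO hs3
  have hf0 : Tendsto f (𝓝[>] 0) (𝓝 0) := hfo.trans_tendsto (tendsto_id.mono_left hle)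
  have htpos : ∀ᶠ s in 𝓝[>] (0 : ℝ), 0 ≤ t s :=
    ht0.eventually_const_le (by have := cutLongitude_pos h.α_pos; positivity)
  obtain ⟨N, hN, hNev⟩ := h.exists_time_longitude
  have htθ : (fun s => t s - S.b * (c (η s) (t s)).2) =O[𝓝[>] 0] fun s => η s ^ 2 := by
    have h1 : (fun s => N * η s ^ 2 * t s) =O[𝓝[>] 0] fun s => η s ^ 2 := by
      simpa using ((isBigO_refl (fun s => η s ^ 2) (𝓝[>] 0)).const_mul_left N).mul
        (ht0.isBigO_one ℝ)
    refine IsBigO.trans (IsBigO.of_bound 1 ?_) h1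
    filter_upwards [hη0.eventually hNev, htpos] with s h2 h3
    rw [one_mul]
    exact (h2 _ h3).trans (le_abs_self _)
  have hη2 : Tendsto (fun s => η s ^ 2) (𝓝[>] 0) (𝓝 0) := tendsto_sq_zero.comp hη0
  have hθ0 : Tendsto (fun s => (c (η s) (t s)).2 - S.cutLongitude) (𝓝[>] 0) (𝓝 0) := by
    have h1 := ((ht0.sub (htθ.trans_tendsto hη2)).div_const S.b).sub_const S.cutLongitude
    have h2 : (S.b * S.cutLongitude - 0) / S.b - S.cutLongitude = 0 := by field_simp; ring
    rw [h2] at h1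
    refine h1.congr fun s => ?_
    field_simp
    ring
  have hθ : ∀ᶠ s in 𝓝[>] (0 : ℝ), |(c (η s) (t s)).2 - S.cutLongitude| ≤ 3 * Real.pi / 2 := by
    have := hθ0.abs
    rw [abs_zero] at this
    exact this.eventually_le_const (by positivity)
  obtain ⟨M', hM', hlow⟩ := h.exists_rdist_lower_bound hc hC.le
  have hη3 : (fun s => η s ^ 3) =O[𝓝[>] 0] f := by
    refine IsBigO.of_bound (2 / S.cubicConst) ?_
    have hsmall : ∀ᶠ s in 𝓝[>] (0 : ℝ), M' * |η s| ≤ S.cubicConst / 2 := by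
      have := (hη0.abs).const_mul M'
      rw [abs_zero, mul_zero] at this
      exact this.eventually_le_const (by positivity)
    filter_upwards [hη0.eventually hlow, htpos, hθ, hsmall] with s h1 h2 h3 h4
    have h5 := h1 _ h2 h3
    have h6 : M' * η s ^ 4 ≤ S.cubicConst / 2 * |η s| ^ 3 := by
      have h7 := mul_le_mul_of_nonneg_right h4 (by positivity : 0 ≤ |η s| ^ 3)
      calc _ = M' * |η s| * |η s| ^ 3 := by
            rw [← Even.pow_abs (by decide : Even 4)]; ring
        _ ≤ _ := h7
    rw [norm_pow, Real.norm_eq_abs, Real.norm_of_nonneg (rdist_nonneg _ _), div_mul_eq_mul_div,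
      le_div_iff₀ hC]
    linarith
  have hηo : η =o[𝓝[>] 0] fun s => s :=
    IsLittleO.of_pow (n := 3) (hη3.trans_isLittleO ho) (by norm_num)
  have hη' : deriv η 0 = 0 := hasDerivAt_eq_zero_of_isLittleO hη (by simpa [hv.η_zero] using hηo)
  obtain ⟨K, κ, hK, hκ, hlong⟩ := S.exists_abs_sub_snd_le_rdist
  have hθo : (fun s => (c (η s) (t s)).2 - S.cutLongitude) =O[𝓝[>] 0] f := by
    refine IsBigO.of_bound K ?_
    filter_upwards [hη0.eventually (eventually_half_b_le hc), hη0.eventually eventually_mem_Ioo_pi,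
      hθ, hf0.eventually_lt_const hκ] with s h1 h2 h3 h4
    rw [Real.norm_eq_abs, Real.norm_of_nonneg (rdist_nonneg _ _)]
    exact hlong _ _ (mem_Icc_of_geodesic (hc _ h2) _) (h1 _) h3 h4
  have hη2o : (fun s => η s ^ 2) =o[𝓝[>] 0] fun s => s := by
    have := (hηo.isBigO).mul_isLittleO ((isLittleO_one_iff ℝ).2 hη0)
    refine this.congr (fun s => ?_) fun s => ?_ <;> ring
  have hto : (fun s => t s - t 0) =o[𝓝[>] 0] fun s => s := by
    refine ((htθ.trans_isLittleO hη2o).add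
      ((hθo.trans_isLittleO hfo).const_mul_left S.b)).congr_left fun s => ?_
    rw [hv.t_zero]
    ring
  have ht' : deriv t 0 = 0 := hasDerivAt_eq_zero_of_isLittleO ht hto
  exact hv.regular.elim (fun h => h hη') fun h => h ht'

/-- The lower bound is the one for single points of `c_η`; the upper bound needs one good point on
the segment. -/
theorem distToSegment_isBigO (h : S.OscillationFamily A₁ A₂ B₁ B₂ M c τ)
    (hm : StrictMonoOn S.m (Icc 0 S.a))
    (hc : ∀ η ∈ Ioo (-(Real.pi / 2)) (Real.pi / 2), S.IsEquatorGeodesic η (c η))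
    (hC : 0 ≤ S.cubicConst) (hcut : S.cutLongitude ≤ Real.pi) :
    (fun η => S.distToSegment (S.a, S.cutLongitude) (c η) (S.φ (S.b * Real.cos η))
      - S.cubicConst * η ^ 3) =O[𝓝[>] 0] fun η => η ^ 4 := by
  have hb := S.b_pos
  have hs := h.sqrt_pos
  have hπ := Real.pi_pos
  have hcut0 := cutLongitude_pos h.α_pos
  have hle : 𝓝[>] (0 : ℝ) ≤ 𝓝 0 := nhdsWithin_le_nhds
  obtain ⟨K, hK, hφ⟩ := (h.φ_isBigO hm hc).exists_pos
  obtain ⟨M₁, hM₁, hlow⟩ := h.exists_rdist_lower_bound hc hC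
  obtain ⟨M₂, hM₂, hheight⟩ := h.exists_height_bound K
  have hlim := h.tendsto_φ hm hc
  have hφpos : ∀ᶠ η in 𝓝[>] (0 : ℝ), 0 < S.φ (S.b * Real.cos η) := hlim.eventually_const_lt hcut0
  have hφle : ∀ᶠ η in 𝓝[>] (0 : ℝ), S.φ (S.b * Real.cos η) ≤ S.cutLongitude + Real.pi :=
    hlim.eventually_le_const (by linarith)
  have hupper : ∀ᶠ η in 𝓝[>] (0 : ℝ), ∃ t, 0 ≤ t ∧ (c η t).2 ≤ S.φ (S.b * Real.cos η) ∧
      S.rdist (c η t) (S.a, S.cutLongitude) ≤ S.cubicConst * η ^ 3 + (M₂ + S.b * K) * η ^ 4 := by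
    have hsmall : ∀ᶠ η in 𝓝[>] (0 : ℝ), η ≤ 1 :=
      hle (eventually_le_nhds one_pos)
    -- If `C > 0`, the return longitude exceeds `θcut` for small `η > 0`, so the point of longitude
    -- `θcut` lies on the segment. If `C = 0`, the segment may end before `θcut`, but its end point
    -- misses that longitude by `O(η⁴)` only.
    rcases hC.eq_or_lt with hC0 | hC0
    · filter_upwards [hφ.bound, hle (h.eventually_exists_longitude_eq hc), hle hheight,
        hφpos, hle eventually_mem_Ioo_pi, hsmall, self_mem_nhdsWithin]
        with η h1 h2 h3 h4 h5 h6 h7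
      have h7' : 0 < η := h7
      obtain ⟨t, ht, ht'⟩ := h2 _ h4.le
      rw [← hC0, zero_div, zero_mul, add_zero, ← ht', norm_pow, Real.norm_eq_abs,
        Real.norm_eq_abs, Even.pow_abs (by decide)] at h1
      have h8 : η ^ 4 ≤ |η| ^ 3 := by
        rw [abs_of_pos h7']
        exact pow_le_pow_of_le_one h7'.le h6 (by norm_num)
      have h9 := h3 t ht (h1.trans (mul_le_mul_of_nonneg_left h8 hK.le))
      rw [← hC0, zero_mul, sub_zero, abs_sub_comm] at h9
      refine ⟨t, ht, ht'.le, ?_⟩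
      have h10 := rdist_le (S := S) (θ := (c η t).2) (θ₀ := S.cutLongitude)
        (mem_Icc_of_geodesic (hc η h5) t)
      have h11 := mul_le_mul_of_nonneg_left h1 hb.le
      rw [← hC0]
      change S.rdist ((c η t).1, (c η t).2) _ ≤ _
      linarith
    · have hsmall' : ∀ᶠ η in 𝓝[>] (0 : ℝ), K * η ^ 2 ≤ S.cubicConst / S.b := by
        have := (tendsto_sq_zero.mono_left hle).const_mul K
        rw [mul_zero] at this
        exact this.eventually_le_const (by positivity)
      filter_upwards [hφ.bound, hle (h.eventually_exists_longitude_eq hc), hle hheight,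
        hle eventually_mem_Ioo_pi, hsmall', self_mem_nhdsWithin] with η h1 h2 h3 h5 h6 h7
      obtain ⟨t, ht, ht'⟩ := h2 _ hcut0.le
      have h9 := h3 t ht (by rw [ht', sub_self, abs_zero]; positivity)
      refine ⟨t, ht, ?_, ?_⟩
      · rw [norm_pow, Real.norm_eq_abs, Real.norm_eq_abs, Even.pow_abs (by decide)] at h1
        have h8 := (abs_le.1 h1).1
        have h10 := mul_le_mul_of_nonneg_right h6 (sq_nonneg η)
        rw [ht']
        nlinarith
      · have h10 := rdist_le (S := S) (θ := (c η t).2) (θ₀ := S.cutLongitude)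
          (mem_Icc_of_geodesic (hc η h5) t)
        rw [ht', sub_self, abs_zero, mul_zero, add_zero, abs_sub_comm] at h10
        have h7' : 0 < η := h7
        have h11 : |S.a - (c η t).1| ≤ S.cubicConst * η ^ 3 + M₂ * η ^ 4 := by
          have h12 : 0 ≤ S.cubicConst * η ^ 3 := by positivity
          have h13 := abs_le.1 h9
          have h14 : 0 ≤ M₂ * η ^ 4 := by positivity
          rw [abs_le]
          constructor <;> linarith
        have h15 : 0 ≤ S.b * K * η ^ 4 := by positivity
        rw [← ht'] at h10 ⊢
        change S.rdist ((c η t).1, (c η t).2) _ ≤ _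
        linarith
  refine IsBigO.of_bound (M₁ + (M₂ + S.b * K)) ?_
  filter_upwards [hupper, hle hlow, hφle, hle h.eventually_bounds, hle h.eventually, hφpos,
    self_mem_nhdsWithin] with η ⟨t, ht, htφ, htd⟩ h2 h3 h4 h5 h6 h7
  have h7' : 0 < η := h7
  have hbdd : BddBelow ((fun t => S.rdist (c η t) (S.a, S.cutLongitude)) ''
      {t | 0 ≤ t ∧ (c η t).2 ≤ S.φ (S.b * Real.cos η)}) := by
    refine ⟨0, ?_⟩
    rintro _ ⟨t, -, rfl⟩
    exact rdist_nonneg _ _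
  have hup : S.distToSegment (S.a, S.cutLongitude) (c η) (S.φ (S.b * Real.cos η))
      ≤ S.cubicConst * η ^ 3 + (M₂ + S.b * K) * η ^ 4 :=
    (csInf_le hbdd ⟨t, ⟨ht, htφ⟩, rfl⟩).trans htd
  have hlo : S.cubicConst * η ^ 3 - M₁ * η ^ 4
      ≤ S.distToSegment (S.a, S.cutLongitude) (c η) (S.φ (S.b * Real.cos η)) := by
    refine le_csInf ⟨_, t, ⟨ht, htφ⟩, rfl⟩ ?_
    rintro _ ⟨v, ⟨hv, hvφ⟩, rfl⟩
    have h8 : 0 ≤ (c η v).2 := by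
      have h9 := (h4 v hv).2.2
      have h10 : 0 ≤ 1 / √(2 * S.α * S.b) * τ η v :=
        mul_nonneg (by positivity) (tau_nonneg h5 hv)
      linarith
    -- Longitudes on the segment lie between `0` and `θcut + π`, and `θcut ≤ π`; so they stay within
    -- `π` of `θcut`, in the range of the lower bound.
    have h9 := h2 v hv (by
      rw [abs_le]
      constructor <;> linarith)
    rwa [abs_of_pos h7'] at h9
  have h8 : 0 ≤ η ^ 4 := by positivity
  rw [Real.norm_eq_abs, Real.norm_of_nonneg h8, abs_le]
  have h9 : 0 ≤ M₁ * η ^ 4 := by positivity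
  have h10 : 0 ≤ (M₂ + S.b * K) * η ^ 4 := by positivity
  constructor <;> linarith

end OscillationFamily

end TwoSphereOfRevolution

/-! ### The theorem -/

theorem mainTheorem3 (S : TwoSphereOfRevolution)
    (hA1 : S.LocallyReflectionSymmetric) (hA2 : S.CurvatureMonotone)
    (c : ℝ → ℝ → ℝ × ℝ)
    (hc : ∀ η ∈ Ioo (-(Real.pi / 2)) (Real.pi / 2), S.IsEquatorGeodesic η (c η)) :
    ∃ θcut : ℝ,
      -- the longitude of the cut-conjugate point, which the equator reaches at time `b θcut`
      Tendsto S.φ (𝓝[<] S.b) (𝓝 θcut) ∧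
      -- some variation reaches within `O(s³)`
      (∃ (ε : ℝ) (η t : ℝ → ℝ), TwoSphereOfRevolution.IsVariation (S.b * θcut) ε η t ∧
        (fun s => S.rdist (c (η s) (t s)) (S.a, θcut)) =O[𝓝 0] fun s => s ^ 3) ∧
      -- no variation reaches within `o(s³)`, not even one-sidedly
      (iteratedDeriv 2 S.K S.a ≠ 0 →
        ¬ ∃ (ε : ℝ) (η t : ℝ → ℝ), TwoSphereOfRevolution.IsVariation (S.b * θcut) ε η t ∧
          (fun s => S.rdist (c (η s) (t s)) (S.a, θcut)) =o[𝓝[>] 0] fun s => s ^ 3) ∧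
      -- the distance to the geodesic segment up to the first return to the equator
      ((fun η => S.distToSegment (S.a, θcut) (c η) (S.φ (S.b * Real.cos η))
          - S.cubicConst * η ^ 3) =O[𝓝[>] 0] fun η => η ^ 4) ∧
      (iteratedDeriv 2 S.K S.a ≠ 0 → 0 < S.cubicConst) := by
  have hα := TwoSphereOfRevolution.α_pos hA1 hA2
  have hC := TwoSphereOfRevolution.cubicConst_nonneg hA1 hA2
  have hm := TwoSphereOfRevolution.strictMonoOn_m hA1 hA2
  obtain ⟨A₁, A₂, B₁, B₂, M, hM, hrel, hev⟩ :=
    TwoSphereOfRevolution.exists_oscillation hA1 hα hc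
  obtain ⟨τ, hτ⟩ := hev.choice
  have h : S.OscillationFamily A₁ A₂ B₁ B₂ M c τ := ⟨hα, hM, hrel, hτ⟩
  exact ⟨S.cutLongitude, h.tendsto_φ_left hm hc, h.exists_variation hc,
    fun hK => h.not_exists_variation hc (TwoSphereOfRevolution.cubicConst_pos hA1 hA2 hK),
    h.distToSegment_isBigO hm hc hC
      (TwoSphereOfRevolution.cutLongitude_le_pi (TwoSphereOfRevolution.one_le_two_α_b hA1 hA2)),
    fun hK => TwoSphereOfRevolution.cubicConst_pos hA1 hA2 hK⟩
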